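/- Let $\Gamma=\langle a,b,t\mid tat^{-1}=ab,\ tbt^{-1}=bab\rangle$ be the group of the figure eight knot, and let $X=X(\Gamma,\mathrm{SL}(3,\mathbb C))$ be its variety of characters: the points of $X$ are the characters $\chi_\rho(\gamma)=\operatorname{tr}\rho(\gamma)$ of the representations $\rho\colon\Gamma\to\mathrm{SL}(3,\mathbb C)$, and the Zariski closed sets are the common zero sets of polynomials in the functions $\chi\mapsto\chi(\gamma)$, $\gamma\in\Gamma$. Let $X_{irr}\subset X$ be the set of characters of irreducible representations. For $\chi\in X$ put \[ \alpha=\chi(a),\quad \bar\alpha=\chi(a^{-1}),\quad \beta=\chi(b),\quad \bar\beta=\chi(b^{-1}),\quad \eta=\chi(aba^{-1}b^{-1}), \] \[ y=\chi(t),\quad \bar y=\chi(t^{-1}),\quad z=\chi(ta^{-1}ta),\quad \bar z=\chi(a^{-1}t^{-1}at^{-1}). \] There is exactly one irreducible component $V_1$ of the Zariski closure $\overline{X_{irr}}$ whose image under $(\alpha,\bar\alpha,\beta,\bar\beta)\colon X\to\mathbb C^4$ has Zariski closure the plane $U_1=\{\alpha=\bar\alpha=1\}$. In the coordinates above, $V_1$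 is described by the equations \[ \alpha=\bar\alpha=1,\quad y\bar y=\beta+\bar\beta+2,\quad y^3+\bar y^3=\beta\bar\beta+5\beta+5\bar\beta+5,\quad \eta=y^3-3(\beta+\bar\beta+1),\quad z=\bar y,\quad \bar z=y . \] That is, $V_1$ is the set of all $\chi\in X$ satisfying these equations, the nine coordinates map $V_1$ bijectively onto the set of all solutions of these equations in $\mathbb C^9$, and these equations generate the ideal of all polynomials in the nine coordinates that vanish on $V_1$. The only characters of reducible representations in $V_1$ are those with coordinates \[ (y,\bar y,z,\bar z,\alpha,\bar\alpha,\beta,\bar\beta)\in\mu_3\cdot(2,2,2,2,1,1,1,1), \] where $\mu_3=\{\omega\in\mathbb C\mid\omega^3=1\}$ acts by $\omega\cdot(y,\bar y,z,\bar z,\alpha,\bar\alpha,\beta,\bar\beta)=(\omega y,\omega^2\bar y,\omega^2z,\omega\bar z,\alpha,\bar\alpha,\beta,\bar\beta)$; all of these points occur, and they are characters of partially reducible representations, i.e. of direct sums of a one-dimensional and an irreducible two-dimensional representation. -/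

import Mathlib

open MvPolynomial

namespace FigEight

noncomputable section

/-! ### The figure eight knot group and its representations in `SL(3, ℂ)` -/

/-- The three generators of the figure eight knot group: `a` and `b` generate the (free) group of
the fibre and `t` is a meridian. -/
inductive Gen
  | a
  | b
  | t

/-- The relators of `⟨a, b, t ∣ t a t⁻¹ = a b, t b t⁻¹ = b a b⟩`. -/
def relators : Set (FreeGroup Gen) :=
  let a := FreeGroup.of Gen.a
  let b := FreeGroup.of Gen.b
  let t := FreeGroup.of Gen.t
  {t * a * t⁻¹ * (a * b)⁻¹, t * b * t⁻¹ * (b * a * b)⁻¹}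

/-- The figure eight knot group `Γ = ⟨a, b, t ∣ t a t⁻¹ = a b, t b t⁻¹ = b a b⟩`. -/
abbrev Knot : Type := PresentedGroup relators

/-- The element `a` of the knot group. -/
def a : Knot := PresentedGroup.of Gen.a

/-- The element `b` of the knot group. -/
def b : Knot := PresentedGroup.of Gen.b

/-- The element `t` of the knot group. -/
def t : Knot := PresentedGroup.of Gen.t

/-- Representations of the knot group in `SL(3, ℂ)`. -/
abbrev SLRep : Type := Knot →* Matrix.SpecialLinearGroup (Fin 3) ℂ

/-- The linear action of the knot group on `ℂ³` given by `ρ : Γ → SL(3, ℂ)`. -/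
def linRep (ρ : SLRep) : Representation ℂ Knot (Fin 3 → ℂ) where
  toFun g := Matrix.toLin' (ρ g : Matrix (Fin 3) (Fin 3) ℂ)
  map_one' := by simp [Module.End.one_eq_id]
  map_mul' g h := by simp [Matrix.toLin'_mul, Module.End.mul_eq_comp]

/-- `ρ` is irreducible: no proper non-zero subspace of `ℂ³` is invariant. -/
def Irred (ρ : SLRep) : Prop := (linRep ρ).IsIrreducible

/-- `ρ` is partially reducible: it is the direct sum of a one-dimensional representation and an
irreducible two-dimensional representation. -/
def PartiallyReducible (ρ : SLRep) : Prop :=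
  ∃ L P : Subrepresentation (linRep ρ),
    IsCompl L.toSubmodule P.toSubmodule ∧
    Module.finrank ℂ L.toSubmodule = 1 ∧ Module.finrank ℂ P.toSubmodule = 2 ∧
    P.toRepresentation.IsIrreducible

/-! ### The variety of characters -/

/-- The character `γ ↦ tr (ρ γ)` of a representation. -/
def charFun (ρ : SLRep) : Knot → ℂ :=
  fun γ => Matrix.trace (ρ γ : Matrix (Fin 3) (Fin 3) ℂ)

/-- The variety of characters `X(Γ, SL(3, ℂ))`: its points are the characters of the
representations of `Γ` in `SL(3, ℂ)`. -/
def CharVar : Type := {f : Knot → ℂ // ∃ ρ : SLRep, f = charFun ρ}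

namespace CharVar

/-- The value `χ γ` of a character. -/
def val (χ : CharVar) (γ : Knot) : ℂ := χ.1 γ

/-- The zero set in `X(Γ, SL(3, ℂ))` of a set of polynomials in the trace functions `χ ↦ χ γ`,
`γ ∈ Γ` (the trace functions generate the ring of regular functions on `X(Γ, SL(3, ℂ))`). -/
def zeros (S : Set (MvPolynomial Knot ℂ)) : Set CharVar :=
  {χ | ∀ p ∈ S, aeval χ.val p = 0}

/-- The Zariski topology on the variety of characters. -/
instance zariski : TopologicalSpace CharVar :=
  TopologicalSpace.ofClosed {Z | ∃ S, Z = zeros S}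
    ⟨{1}, by ext χ; simp [zeros]⟩
    (by
      intro 𝒜 h𝒜
      refine ⟨{p | ∃ S, p ∈ S ∧ zeros S ∈ 𝒜}, ?_⟩
      ext χ
      constructor
      · rintro h p ⟨S, hp, hS⟩
        exact h _ hS p hp
      · intro h Z hZ
        obtain ⟨S, rfl⟩ := h𝒜 hZ
        exact fun p hp => h p ⟨S, hp, hZ⟩)
    (by
      rintro _ ⟨S, rfl⟩ _ ⟨S', rfl⟩
      refine ⟨{r | ∃ p ∈ S, ∃ q ∈ S', r = p * q}, ?_⟩
      ext χ
      constructor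
      · rintro (h | h) _ ⟨p, hp, q, hq, rfl⟩
        · rw [map_mul, h p hp, zero_mul]
        · rw [map_mul, h q hq, mul_zero]
      · intro h
        by_contra hn
        have h1 : ¬ ∀ p ∈ S, aeval χ.val p = 0 := fun h' => hn (Or.inl h')
        have h2 : ¬ ∀ p ∈ S', aeval χ.val p = 0 := fun h' => hn (Or.inr h')
        push Not at h1 h2
        obtain ⟨p, hp, hp0⟩ := h1
        obtain ⟨q, hq, hq0⟩ := h2
        have := h (p * q) ⟨p, hp, q, hq, rfl⟩
        rw [map_mul] at this
        exact (mul_ne_zero hp0 hq0) this)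

/-- The Zariski closed sets are the common zero sets of polynomials in the trace functions. -/
theorem isClosed_iff (Z : Set CharVar) : IsClosed Z ↔ ∃ S, Z = zeros S := by
  rw [← isOpen_compl_iff]
  change Zᶜᶜ ∈ {Z | ∃ S, Z = zeros S} ↔ _
  rw [compl_compl]
  rfl

end CharVar

/-- The set of irreducible characters. -/
def Xirr : Set CharVar := {χ | ∃ ρ, Irred ρ ∧ χ.val = charFun ρ}

/-- The set of reducible characters. -/
def Xred : Set CharVar := {χ | ∃ ρ, ¬ Irred ρ ∧ χ.val = charFun ρ}

/-- The set of characters of partially reducible representations. -/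
def Xpr : Set CharVar := {χ | ∃ ρ, PartiallyReducible ρ ∧ χ.val = charFun ρ}

/-! ### Coordinates -/

/-- Names of the coordinates `α, ᾱ, β, β̄, η, y, ȳ, z, z̄`. -/
inductive Coord
  | α
  | α'
  | β
  | β'
  | η
  | y
  | y'
  | z
  | z'

/-- The group element whose trace is the given coordinate. -/
def Coord.elt : Coord → Knot
  | .α => a
  | .α' => a⁻¹
  | .β => b
  | .β' => b⁻¹
  | .η => a * b * a⁻¹ * b⁻¹
  | .y => t
  | .y' => t⁻¹
  | .z => t * a⁻¹ * t * a
  | .z' => a⁻¹ * t⁻¹ * a * t⁻¹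

/-- The nine coordinates of a character. -/
def coords (χ : CharVar) : Coord → ℂ := fun c => χ.val c.elt

/-- The eight coordinates `(y, ȳ, z, z̄, α, ᾱ, β, β̄)` of a character. -/
def coords8 (χ : CharVar) : Fin 8 → ℂ :=
  ![coords χ .y, coords χ .y', coords χ .z, coords χ .z',
    coords χ .α, coords χ .α', coords χ .β, coords χ .β']

/-- The action of a third root of unity on `ℂ⁸` that corresponds to the action of the centre of
`SL(3, ℂ)` on characters:
`ω • (y, ȳ, z, z̄, α, ᾱ, β, β̄) = (ω y, ω² ȳ, ω² z, ω z̄, α, ᾱ, β, β̄)`. -/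
def centreAct (ω : ℂ) (x : Fin 8 → ℂ) : Fin 8 → ℂ :=
  ![ω * x 0, ω ^ 2 * x 1, ω ^ 2 * x 2, ω * x 3, x 4, x 5, x 6, x 7]

/-! ### The component `V₁` -/

/-- The projection `χ ↦ (α, ᾱ, β, β̄)`, which depends only on the restriction of `χ` to the group
`⟨a, b⟩` of the fibre. -/
def fibreProj (χ : CharVar) : Fin 4 → ℂ :=
  ![coords χ .α, coords χ .α', coords χ .β, coords χ .β']

/-- The plane `U₁ = {α = ᾱ = 1}` in the space `ℂ⁴` of `(α, ᾱ, β, β̄)`. -/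
def U1 : Set (Fin 4 → ℂ) := {x | x 0 = 1 ∧ x 1 = 1}

/-- `V` is an irreducible component of the Zariski closure of the set of irreducible characters. -/
def IsIrrComponent (V : Set CharVar) : Prop :=
  Maximal (fun Z : Set CharVar => IsIrreducible Z ∧ Z ⊆ closure Xirr) V

/-- `V` is a (the) component `V₁`: the irreducible component of the closure of the set of
irreducible characters that lies over `U₁`, that is, whose image under `χ ↦ (α, ᾱ, β, β̄)` is
Zariski dense in `U₁`. -/
def IsV1 (V : Set CharVar) : Prop :=
  IsIrrComponent V ∧ zeroLocus ℂ (vanishingIdeal ℂ (fibreProj '' V)) = U1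

/-- The equations of `V₁`, as polynomials in the nine coordinates:
`α = 1`, `ᾱ = 1`, `y ȳ = β + β̄ + 2`, `y³ + ȳ³ = β β̄ + 5 β + 5 β̄ + 5`,
`η = y³ - 3 (β + β̄ + 1)`, `z = ȳ`, `z̄ = y`. -/
def eqsV1 : Set (MvPolynomial Coord ℂ) :=
  {X .α - 1,
   X .α' - 1,
   X .y * X .y' - (X .β + X .β' + 2),
   X .y ^ 3 + X .y' ^ 3 - (X .β * X .β' + 5 * X .β + 5 * X .β' + 5),
   X .η - (X .y ^ 3 - 3 * (X .β + X .β' + 1)),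
   X .z - X .y',
   X .z' - X .y}

end

end FigEight

open FigEight

/-! ### Cayley–Hamilton identities and pairs of matrices of order three -/

namespace FigEight

noncomputable section

/-! Put l = a⁻¹t (this is `el`) and k = al⁻¹. Then a = kl, t = kl² and b = lkl⁻¹k⁻¹, and V₁ consists
of the characters for which k and l have eigenvalues 1, ω, ω² and kl has eigenvalues 1, i, −i
(`TriPair`, `GivenBy`). For such pairs k² = k⁻¹ and l² = l⁻¹, and Cayley–Hamilton rewrites klk, kl²k
and the like linearly. The free parameters are y = tr kl⁻¹ and ȳ = tr k⁻¹l; the traces β, β̄ of the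
commutator and its inverse have sum yȳ − 2 and product y³ + ȳ³ − 5yȳ + 5. The knot relation follows
from these rules (`conj_relation`), so every such pair defines a representation.

Conversely, conjugation by t preserves traces, whence (α − 1)(β − β̄) = (ᾱ − 1)(β − β̄) = 0 on all
of X; and if α = ᾱ = 1, then χ(l)(β − β̄) = 0. So β ≠ β̄ forces the pair form, and an irreducible
set on which β − β̄ is not identically zero lies in V₁ (`subset_V1`). This gives both maximality and
uniqueness. Where β = β̄, the equation yȳ = β + β̄ + 2 still forces χ(l) = 0 (`charFun_el_eq_zero`).

On V₁ every trace is a polynomial in the coordinates, uniformly in the representation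
(`PolyComb.mul_left`), so the coordinates are injective; explicit matrices make them surjective. The
equations cut out ℂ[y, ȳ][β] modulo an irreducible quadratic, so their ideal is prime and the
Nullstellensatz applies. A reducible representation in V₁ gives k and l, or their transposes, a
common eigenvector, which forces ȳ = 2κ, y = 2κ² with κ³ = 1. -/

/-- Complex `3 × 3` matrices. -/
abbrev Mat3 : Type := Matrix (Fin 3) (Fin 3) ℂ

/-- Partially polarised Cayley–Hamilton identity. -/
theorem sandwich (X U : Mat3) :
    X * U * X = (X * U).trace • X + X.adjugate.trace • U + U.trace • X.adjugate
      + ((X.adjugate * U).trace - U.trace * X.adjugate.trace) • (1 : Mat3)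
      - X.adjugate * U - U * X.adjugate := by
  ext i j
  fin_cases i <;> fin_cases j <;>
    simp [Matrix.adjugate_fin_three, Matrix.mul_apply, Fin.sum_univ_three, Matrix.trace_fin_three,
      Matrix.vecMul, dotProduct] <;>
    ring

/-- Fully polarised Cayley–Hamilton identity. -/
theorem trilinear_cayley_hamilton (X Y Z : Mat3) :
    X * Y * Z + X * Z * Y + Y * X * Z + Y * Z * X + Z * X * Y + Z * Y * X =
      X.trace • (Y * Z + Z * Y) + Y.trace • (X * Z + Z * X) + Z.trace • (X * Y + Y * X)
      - (X.trace * Y.trace - (X * Y).trace) • Z - (X.trace * Z.trace - (X * Z).trace) • Y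
      - (Y.trace * Z.trace - (Y * Z).trace) • X
      + (X.trace * Y.trace * Z.trace - X.trace * (Y * Z).trace - Y.trace * (X * Z).trace
        - Z.trace * (X * Y).trace + (X * Y * Z).trace + (X * Z * Y).trace) • (1 : Mat3) := by
  ext i j
  fin_cases i <;> fin_cases j <;>
    simp [Matrix.mul_apply, Fin.sum_univ_three, Matrix.trace_fin_three] <;>
    ring

theorem cayley_hamilton_three (X : Mat3) :
    X * X = X.trace • X - X.adjugate.trace • (1 : Mat3) + X.adjugate := by
  ext i j
  fin_cases i <;> fin_cases j <;>
    simp [Matrix.adjugate_fin_three, Matrix.mul_apply, Fin.sum_univ_three, Matrix.trace_fin_three] <;>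
    ring

/-- Pairs of matrices of order three with eigenvalues `1, ω, ω²` such that `k * l` has
eigenvalues `1, i, -i`, together with the traces of `k * l⁻¹` and `k⁻¹ * l`. -/
structure TriPair (k l : Mat3) (y y' : ℂ) : Prop where
  kkk : k * k * k = 1
  lll : l * l * l = 1
  tr_k : k.trace = 0
  tr_kk : (k * k).trace = 0
  tr_l : l.trace = 0
  tr_ll : (l * l).trace = 0
  tr_kl : (k * l).trace = 1
  tr_kll : (k * l * l).trace = y
  tr_kkl : (k * k * l).trace = y'
  tr_kkll : (k * k * l * l).trace = 1

/-- The trace of the Cayley–Hamilton identity shows that the adjugate has trace zero as well.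
Squares can thus replace inverses throughout. -/
theorem adjugate_eq_sq {x : Mat3} (h0 : x.trace = 0) (h1 : (x * x).trace = 0) :
    x.adjugate = x * x := by
  have h := cayley_hamilton_three x
  have h2 := congrArg Matrix.trace h
  simp [h0, h1] at h2
  have h3 : x.adjugate.trace = 0 := by linear_combination (1 / 2 : ℂ) * h2
  rw [h0, h3] at h
  simpa using h.symm

theorem sandwich_of_trace_eq_zero {x : Mat3} (h0 : x.trace = 0) (h1 : (x * x).trace = 0)
    (u : Mat3) :
    x * u * x = (x * u).trace • x + u.trace • (x * x) + (x * x * u).trace • (1 : Mat3)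
      - x * x * u - u * (x * x) := by
  have h := sandwich x u
  rw [adjugate_eq_sq h0 h1, h1] at h
  simpa [sub_eq_add_neg, add_assoc, add_left_comm, add_comm] using h

namespace TriPair

variable {k l : Mat3} {y y' : ℂ} (h : TriPair k l y y')
include h

theorem symm : TriPair l k y' y where
  kkk := h.lll
  lll := h.kkk
  tr_k := h.tr_l
  tr_kk := h.tr_ll
  tr_l := h.tr_k
  tr_ll := h.tr_kk
  tr_kl := by rw [Matrix.trace_mul_comm, h.tr_kl]
  tr_kll := by rw [mul_assoc, Matrix.trace_mul_comm, h.tr_kkl]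
  tr_kkl := by rw [Matrix.trace_mul_comm, ← mul_assoc, h.tr_kll]
  tr_kkll := by rw [mul_assoc, Matrix.trace_mul_comm, ← mul_assoc, h.tr_kkll]

/-- Transposition reverses words: it keeps y and ȳ but exchanges the traces of the commutator and of
its inverse. -/
theorem transpose : TriPair k.transpose l.transpose y y' := by
  constructor <;> simp only [← Matrix.transpose_mul, ← mul_assoc, Matrix.trace_transpose]
  · rw [h.kkk, Matrix.transpose_one]
  · rw [h.lll, Matrix.transpose_one]
  · exact h.tr_k
  · exact h.tr_kk
  · exact h.tr_l
  · exact h.tr_ll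
  · exact h.symm.tr_kl
  · exact h.symm.tr_kkl
  · exact h.symm.tr_kll
  · exact h.symm.tr_kkll

theorem k_cancel (x : Mat3) : k * (k * (k * x)) = x := by
  rw [← mul_assoc, ← mul_assoc, h.kkk, one_mul]

theorem k_cube : k * (k * k) = 1 := by rw [← mul_assoc, h.kkk]

theorem klk : k * l * k = k + y' • (1 : Mat3) - k * k * l - l * (k * k) := by
  rw [sandwich_of_trace_eq_zero h.tr_k h.tr_kk, h.tr_kl, h.tr_l, h.tr_kkl]
  simp

theorem kllk : k * (l * l) * k = y • k + (1 : Mat3) - k * k * (l * l) - l * l * (k * k) := by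
  rw [sandwich_of_trace_eq_zero h.tr_k h.tr_kk, ← mul_assoc, h.tr_kll, h.tr_ll, ← mul_assoc,
    h.tr_kkll]
  simp

theorem kklkk : k * k * l * (k * k) = y' • (k * k) + (1 : Mat3) - k * l - l * k := by
  have h1 : k * k * (k * k) = k := by rw [← mul_assoc, h.kkk, one_mul]
  rw [sandwich_of_trace_eq_zero h.tr_kk (by rw [h1, h.tr_k]), h1, h.tr_kkl, h.tr_l, h.tr_kl]
  simp

theorem kkllkk :
    k * k * (l * l) * (k * k) = k * k + y • (1 : Mat3) - k * (l * l) - l * l * k := by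
  have h1 : k * k * (k * k) = k := by rw [← mul_assoc, h.kkk, one_mul]
  rw [sandwich_of_trace_eq_zero h.tr_kk (by rw [h1, h.tr_k]), h1, ← mul_assoc, h.tr_kkll, h.tr_ll,
    ← mul_assoc, h.tr_kll]
  simp

end TriPair

/-! ### The commutator of k and l and its trace -/

set_option linter.unusedSimpArgs false
namespace TriPair

variable {k l : Mat3} {y y' : ℂ} (h : TriPair k l y y')
include h

/-- Polarised Cayley–Hamilton for k, l and k⁻¹l⁻¹: three of the six products are 1, and `kllk`
reduces the other three to the commutator and its inverse. -/
theorem two_commutator_sub :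
    (2 : ℂ) • (k * (l * (k * (k * (l * l))))) - l * (k * (l * (l * (k * k)))) =
      k * l + k * (k * (l * l)) + (k * (l * (k * (k * (l * l))))).trace • (1 : Mat3)
        - y • (l * (k * k)) - y • (k * (k * l)) + y' • (k * (l * l)) := by
  have t := trilinear_cayley_hamilton k l (k * (k * (l * l)))
  have e1 := congrArg (fun m => l * (k * m)) h.kllk
  have e2 := congrArg (fun m => k * m * l) h.kllk
  have e3 := congrArg (fun m => k * (l * m)) h.symm.kllk
  have tkl := h.tr_kl
  have tll := h.tr_ll
  have tkkll := h.tr_kkll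
  have tl : (l * (k * (k * (l * l)))).trace = 0 := by
    rw [Matrix.trace_mul_comm]
    simp only [mul_assoc, h.symm.k_cube, mul_one, h.tr_kk]
  simp only [mul_assoc, mul_add, mul_sub, add_mul, sub_mul, mul_smul_comm, smul_mul_assoc, mul_one,
    one_mul, h.k_cube, h.k_cancel, h.symm.k_cube, h.symm.k_cancel, h.tr_k, h.tr_l, tkl, tll,
    tl, Matrix.trace_one, Fintype.card_fin, Nat.cast_ofNat] at t e1 e2 e3 tkkll
  rw [tkkll] at t
  linear_combination (norm := module) t - e1 - e2 + e3

theorem trace_lkk : (l * (k * k)).trace = y' := by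
  rw [← mul_assoc]; exact h.symm.tr_kll

theorem trace_kkl : (k * (k * l)).trace = y' := by
  rw [← mul_assoc]; exact h.tr_kkl

theorem trace_kll : (k * (l * l)).trace = y := by
  rw [← mul_assoc]; exact h.tr_kll

theorem trace_kkll : (k * (k * (l * l))).trace = 1 := by
  simpa only [mul_assoc] using h.tr_kkll

theorem trace_kllk : (k * (l * (l * k))).trace = 1 := by
  rw [Matrix.trace_mul_comm]; simpa only [mul_assoc] using h.symm.tr_kkll

/-- The sum of the traces of a commutator and its inverse. -/
theorem trace_add_trace :
    (l * (k * (l * (l * (k * k))))).trace + (k * (l * (k * (k * (l * l))))).trace = y * y' - 2 := by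
  have e := congrArg Matrix.trace h.two_commutator_sub
  simp only [Matrix.trace_add, Matrix.trace_sub, Matrix.trace_smul, smul_eq_mul, h.tr_kl,
    h.trace_kkll, h.trace_lkk, h.trace_kkl, h.symm.trace_lkk, Matrix.trace_one, Fintype.card_fin,
    Nat.cast_ofNat] at e
  linear_combination -e

/-- `two_commutator_sub` and its mirror image are two linear equations for the two commutators, with
determinant 3. -/
theorem three_commutator {β β' : ℂ} (hβ : (l * (k * (l * (l * (k * k))))).trace = β)
    (hβ' : (k * (l * (k * (k * (l * l))))).trace = β') :
    (3 : ℂ) • (k * (l * (k * (k * (l * l))))) =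
      (2 : ℂ) • (k * l) + l * k + (2 : ℂ) • (k * (k * (l * l))) + l * (l * (k * k))
        + (2 * β' + β) • (1 : Mat3) - y • (l * (k * k)) - (2 * y) • (k * (k * l))
        + y' • (k * (l * l)) - y' • (l * (l * k)) := by
  have e1 := h.two_commutator_sub
  have e2 := h.symm.two_commutator_sub
  rw [hβ'] at e1
  rw [hβ] at e2
  linear_combination (norm := module) (2 : ℂ) • e1 + e2

theorem trace_sq : (k * (l * (k * l))).trace = -1 := by
  have e := congrArg (fun m => (m * l).trace) h.klk
  simp only [mul_assoc, add_mul, sub_mul, smul_mul_assoc, one_mul, Matrix.trace_add,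
    Matrix.trace_sub, Matrix.trace_smul, smul_eq_mul, h.tr_kl, h.tr_l, h.trace_kkll,
    h.symm.trace_kllk] at e
  linear_combination e

theorem trace_kllkll : (k * (l * (l * (k * (l * l))))).trace = y ^ 2 - 2 * y' := by
  have e := congrArg (fun m => (m * (l * l)).trace) h.kllk
  have e1 : (l * (l * (k * (k * (l * l))))).trace = y' := by
    have r := Matrix.trace_mul_comm (l * l) (k * (k * (l * l)))
    simp only [mul_assoc, h.symm.k_cube, mul_one] at r
    rw [r, h.trace_kkl]
  simp only [mul_assoc, add_mul, sub_mul, smul_mul_assoc, one_mul, Matrix.trace_add,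
    Matrix.trace_sub, Matrix.trace_smul, smul_eq_mul, h.tr_ll, h.symm.k_cancel, h.trace_kkl,
    h.symm.trace_lkk, e1] at e
  linear_combination e

theorem trace_kklkll : (k * (k * (l * (k * (l * l))))).trace =
    (l * (k * (l * (l * (k * k))))).trace := by
  have e := congrArg (fun m => (k * (m * (l * l))).trace) h.klk
  simp only [mul_assoc, add_mul, sub_mul, mul_add, mul_sub, smul_mul_assoc, mul_smul_comm,
    one_mul, h.k_cube, h.k_cancel, mul_one, h.symm.k_cube,
    Matrix.trace_add, Matrix.trace_sub, Matrix.trace_smul, smul_eq_mul, h.trace_kkll,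
    h.symm.trace_lkk, Matrix.trace_one, Fintype.card_fin, Nat.cast_ofNat] at e
  linear_combination e - h.trace_add_trace

/-- This word is t³, and [a, b] reduces to the same word, so this computes η. The value is the third
power sum for the elementary symmetric functions y, ȳ, 1. -/
theorem trace_kll_cube : (k * (l * (l * (k * (l * (l * (k * (l * l)))))))).trace
    = y ^ 3 - 3 * y * y' + 3 := by
  have e := congrArg (fun m => (m * (l * (l * (k * (l * l))))).trace) h.kllk
  have r1 := Matrix.trace_mul_comm (l * l) (k * (l * l))
  have r2 := Matrix.trace_mul_comm (l * l) (k * (k * (l * (l * (k * (l * l))))))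
  have r3 := Matrix.trace_mul_comm (k * (k * (l * (l * k)))) l
  have r4 := Matrix.trace_mul_comm (l * (k * (k * (l * l)))) k
  have hs := h.trace_add_trace
  simp only [mul_assoc, add_mul, sub_mul, smul_mul_assoc, one_mul, h.symm.k_cube, mul_one,
    h.symm.k_cancel, Matrix.trace_add, Matrix.trace_sub, Matrix.trace_smul, smul_eq_mul,
    h.trace_kllkll, h.trace_kklkll, h.tr_kl] at e r1 r2 r3 r4
  rw [r1, r2, r3, r4] at e
  linear_combination e - hs

/-- The product of the traces of a commutator and its inverse. -/
theorem trace_mul_trace :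
    (l * (k * (l * (l * (k * k))))).trace * (k * (l * (k * (k * (l * l))))).trace =
      y ^ 3 + y' ^ 3 - 5 * y * y' + 5 := by
  obtain ⟨β, hβ⟩ : ∃ β, (l * (k * (l * (l * (k * k))))).trace = β := ⟨_, rfl⟩
  obtain ⟨β', hβ'⟩ : ∃ β', (k * (l * (k * (k * (l * l))))).trace = β' := ⟨_, rfl⟩
  have hs := h.trace_add_trace
  -- Multiplication by the inverse commutator turns the left side into 3 · 1, of trace 9; the words
  -- on the right are evaluated one by one below.
  have e := congrArg (fun m => (m * (l * (k * (l * (l * (k * k)))))).trace)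
    (h.three_commutator hβ hβ')
  rw [hβ, hβ'] at hs ⊢
  have zk : (k * (l * (l * (k * k)))).trace = 0 := by
    have r := Matrix.trace_mul_comm (k * (l * l)) (k * k)
    simp only [mul_assoc, h.k_cancel] at r
    rw [r, h.tr_ll]
  have zl : (k * (l * (k * k))).trace = 0 := by
    have r := Matrix.trace_mul_comm (k * l) (k * k)
    simp only [mul_assoc, h.k_cancel] at r
    rw [r, h.tr_l]
  have zl' : (l * (k * (l * l))).trace = 0 := by
    have r := Matrix.trace_mul_comm (l * k) (l * l)
    simp only [mul_assoc, h.symm.k_cancel] at r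
    rw [r, h.tr_k]
  have t6 : (k * (k * (l * (l * (k * k))))).trace = y := by
    have r := Matrix.trace_mul_comm (k * (k * (l * l))) (k * k)
    simp only [mul_assoc, h.k_cancel] at r
    rw [r, h.trace_kll]
  have t1 : (k * (l * (l * (k * (l * (l * (k * k))))))).trace = 1 := by
    have e := congrArg Matrix.trace h.symm.kklkk
    have r := Matrix.trace_mul_comm (k * (l * (l * (k * (l * l))))) (k * k)
    simp only [mul_assoc, h.k_cancel, Matrix.trace_add,
      Matrix.trace_sub, Matrix.trace_smul, smul_eq_mul, h.tr_ll, h.tr_kl, h.symm.tr_kl,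
      Matrix.trace_one, Fintype.card_fin, Nat.cast_ofNat] at e r
    linear_combination r + e
  have t0 : (l * (l * (k * (k * (l * (l * (k * k))))))).trace = -1 := by
    have e := congrArg (fun m => (m * (k * k)).trace) h.symm.kkllkk
    simp only [mul_assoc, add_mul, sub_mul, smul_mul_assoc, one_mul, h.k_cube, h.k_cancel, mul_one,
      Matrix.trace_add, Matrix.trace_sub, Matrix.trace_smul, smul_eq_mul, h.tr_kk, h.symm.tr_kl,
      h.symm.trace_kkll] at e
    have e1 : (k * (k * (l * (k * k)))).trace = 1 := by
      have r := Matrix.trace_mul_comm (k * (k * l)) (k * k)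
      simp only [mul_assoc, h.k_cancel, h.k_cube, mul_one] at r
      rw [r, h.tr_kl]
    rw [e1] at e
    linear_combination e
  have t2 : (l * (k * (l * (k * (l * (l * (k * k))))))).trace = β := by
    have e := congrArg (fun m => (m * (k * (l * (l * (k * k))))).trace) h.symm.klk
    simp only [mul_assoc, add_mul, sub_mul, smul_mul_assoc, one_mul, h.k_cube, h.k_cancel, mul_one,
      Matrix.trace_add, Matrix.trace_sub, Matrix.trace_smul, smul_eq_mul, hβ, zk, t0, t1] at e
    linear_combination e
  have s := h.trace_kklkll.trans hβ
  have t3 : (l * (l * (k * (k * (l * (k * (l * (l * (k * k))))))))).trace = β := by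
    have e := congrArg (fun m => (m * (l * (k * (l * l)))).trace) h.kkllkk
    have e1 : (l * (l * (k * (l * (k * (l * l)))))).trace = -1 := by
      have r := Matrix.trace_mul_comm (l * l) (k * (l * (k * (l * l))))
      simp only [mul_assoc, mul_one, h.symm.k_cube] at r
      rw [r, h.trace_sq]
    simp only [mul_assoc, add_mul, sub_mul, smul_mul_assoc, one_mul, h.symm.k_cube,
      h.symm.k_cancel, mul_one, h.trace_kkll,
      Matrix.trace_add, Matrix.trace_sub, Matrix.trace_smul, smul_eq_mul, s, e1, zl'] at e
    have r := Matrix.trace_mul_comm (l * (l * (k * (k * (l * (k * (l * l))))))) (k * k)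
    simp only [mul_assoc] at r
    linear_combination r + e
  have t5 : (k * (k * (l * (l * (k * (l * (l * (k * k)))))))).trace = y ^ 2 - 2 * y' := by
    have r := Matrix.trace_mul_comm (k * (k * (l * (l * (k * (l * l)))))) (k * k)
    simp only [mul_assoc, h.k_cancel] at r
    rw [r, h.trace_kllkll]
  have t4 : (l * (k * (k * (l * (k * (l * (l * (k * k)))))))).trace = y' * β + y' - y ^ 2 := by
    have e := congrArg (fun m => (m * (k * (l * (l * (k * k))))).trace) h.symm.kllk
    simp only [mul_assoc, add_mul, sub_mul, smul_mul_assoc, one_mul, h.k_cube, h.k_cancel, mul_one,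
      Matrix.trace_add, Matrix.trace_sub, Matrix.trace_smul, smul_eq_mul, h.symm.k_cancel, hβ, zk,
      t5, h.trace_lkk] at e
    linear_combination e
  have t7 : (l * (l * (k * (l * (k * (l * (l * (k * k)))))))).trace = y' ^ 2 - y := by
    have e := congrArg (fun m => (l * (l * (m * (l * (l * (k * k)))))).trace) h.klk
    have e1 := congrArg (fun m => (m * (k * k)).trace) h.symm.kklkk
    simp only [mul_assoc, add_mul, sub_mul, mul_add, mul_sub, smul_mul_assoc, mul_smul_comm,
      one_mul, h.k_cube, h.k_cancel, mul_one, h.symm.k_cube, h.symm.k_cancel, h.symm.trace_kkll,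
      Matrix.trace_add, Matrix.trace_sub, Matrix.trace_smul, smul_eq_mul, h.tr_kk, h.tr_l, zl, t6,
      h.symm.tr_kl, h.trace_lkk, h.symm.trace_kkl] at e e1
    linear_combination e + e1
  simp only [mul_assoc, add_mul, sub_mul, smul_mul_assoc, one_mul, h.k_cube, h.k_cancel, mul_one,
    h.symm.k_cube, h.symm.k_cancel,
    Matrix.trace_add, Matrix.trace_sub, Matrix.trace_smul, smul_eq_mul, hβ, t1, t2, t3, t4, t5, t6,
    t7, h.symm.trace_kkll, Matrix.trace_one, Fintype.card_fin, Nat.cast_ofNat] at e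
  linear_combination -e - β * hs

end TriPair

/-! ### The knot relation and common eigenvectors -/

namespace TriPair

variable {k l : Mat3} {y y' : ℂ} (h : TriPair k l y y')
include h

/-- This is Cayley–Hamilton for kl, with characteristic polynomial X³ − X² + X − 1 and (kl)⁻¹ =
l²k². -/
theorem klkl : k * (l * (k * l)) = k * l - 1 + l * (l * (k * k)) := by
  have e1 := congrArg (fun m => m * l) h.klk
  have e2 := h.symm.kllk
  simp only [mul_assoc, add_mul, sub_mul, smul_mul_assoc, one_mul] at e1 e2
  linear_combination (norm := module) e1 - e2

/-- This is what remains of the relation tb = (bab)t after substituting a = kl, b = lkl²k², t = kl²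
and cancelling cubes. -/
theorem conj_relation : k * (k * (l * (l * (k * k)))) = l * (k * (l * (k * l))) := by
  have e1 := congrArg (fun m => l * m) h.klkl
  have e2 := h.symm.klk
  have e3 := h.kkllkk
  simp only [mul_assoc, mul_add, mul_sub, mul_one, h.symm.k_cancel] at e1 e2 e3
  linear_combination (norm := module) e3 - e1 - e2

/-- A common eigenvector determines the traces. -/
theorem of_common_eigenvector {v : Fin 3 → ℂ} (hv : v ≠ 0) {κ lam : ℂ} (hk : k.mulVec v = κ • v)
    (hl : l.mulVec v = lam • v) : κ ^ 3 = 1 ∧ y' = 2 * κ ∧ y = 2 * κ ^ 2 := by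
  have key : ∀ c : ℂ, c • v = 0 → c = 0 := fun c hc => (smul_eq_zero.mp hc).resolve_right hv
  have hk3 : κ ^ 3 = 1 := by
    have e := congrArg (fun m => Matrix.mulVec m v) h.k_cube
    simp only [← Matrix.mulVec_mulVec, hk, Matrix.mulVec_smul, Matrix.one_mulVec] at e
    refine sub_eq_zero.mp (key _ ?_)
    linear_combination (norm := module) e
  have hl3 : lam ^ 3 = 1 := by
    have e := congrArg (fun m => Matrix.mulVec m v) h.symm.k_cube
    simp only [← Matrix.mulVec_mulVec, hl, Matrix.mulVec_smul, Matrix.one_mulVec] at e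
    refine sub_eq_zero.mp (key _ ?_)
    linear_combination (norm := module) e
  -- Both klkl and l²k² act on v by (κλ)², so `klkl` leaves κλ = 1.
  have h1 : κ * lam - 1 = 0 := by
    have e := congrArg (fun m => Matrix.mulVec m v) h.klkl
    simp only [← Matrix.mulVec_mulVec, hk, hl, Matrix.mulVec_smul, Matrix.one_mulVec,
      Matrix.add_mulVec, Matrix.sub_mulVec] at e
    refine key _ ?_
    linear_combination (norm := module) -e
  have h2 : y' = 2 * κ := by
    have e := congrArg (fun m => Matrix.mulVec m v) h.klk
    simp only [← Matrix.mulVec_mulVec, hk, hl, Matrix.mulVec_smul, Matrix.one_mulVec,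
      Matrix.add_mulVec, Matrix.sub_mulVec, Matrix.smul_mulVec] at e
    have : 3 * (κ * (κ * lam)) - κ - y' = 0 := by
      refine key _ ?_
      linear_combination (norm := module) e
    linear_combination -this + 3 * κ * h1
  have h3 : 3 * (κ * lam) ^ 2 - y * κ - 1 = 0 := by
    have e := congrArg (fun m => Matrix.mulVec m v) h.kllk
    simp only [← Matrix.mulVec_mulVec, hk, hl, Matrix.mulVec_smul, Matrix.one_mulVec,
      Matrix.add_mulVec, Matrix.sub_mulVec, Matrix.smul_mulVec] at e
    refine key _ ?_
    linear_combination (norm := module) e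
  refine ⟨hk3, h2, ?_⟩
  linear_combination (-κ ^ 2) * h3 + (-y) * hk3 + 3 * κ ^ 2 * (κ * lam + 1) * h1

end TriPair

/-! ### Words in k and l with polynomial coefficients -/

/-- Combinations, with polynomials in the coordinates `x` as coefficients, of short words in two
families of matrices `k` and `l`. -/
inductive PolyComb {ι : Type} (x : ι → Coord → ℂ) (k l : ι → Mat3) : (ι → Mat3) → Prop
  | kl (e f : ℕ) : PolyComb x k l fun i => k i ^ e * l i ^ f
  | lk (e f : ℕ) : PolyComb x k l fun i => l i ^ e * k i ^ f
  | klk (f : ℕ) : PolyComb x k l fun i => k i * l i ^ f * k i ^ 2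
  | lkl (e : ℕ) : PolyComb x k l fun i => l i * k i ^ e * l i ^ 2
  | add {m n : ι → Mat3} : PolyComb x k l m → PolyComb x k l n → PolyComb x k l fun i => m i + n i
  | smul (p : MvPolynomial Coord ℂ) {m : ι → Mat3} :
      PolyComb x k l m → PolyComb x k l fun i => aeval (x i) p • m i

namespace PolyComb

variable {ι : Type} {x : ι → Coord → ℂ} {k l m n : ι → Mat3}

theorem symm (h : PolyComb x k l m) : PolyComb x l k m := by
  induction h with
  | kl e f => exact .lk e f
  | lk e f => exact .kl e f
  | klk f => exact .lkl f
  | lkl e => exact .klk e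
  | add _ _ h1 h2 => exact .add h1 h2
  | smul p _ h1 => exact .smul p h1

theorem csmul (c : ℂ) (h : PolyComb x k l m) : PolyComb x k l fun i => c • m i := by
  simpa using h.smul (C c)

theorem sub (h : PolyComb x k l m) (h' : PolyComb x k l n) :
    PolyComb x k l fun i => m i - n i := by
  simpa [sub_eq_add_neg] using h.add (h'.csmul (-1))

theorem one : PolyComb x k l fun _ => 1 := by simpa using kl (x := x) (k := k) (l := l) 0 0

variable {Y Y' B B' : MvPolynomial Coord ℂ}
  (h : ∀ i, TriPair (k i) (l i) (aeval (x i) Y) (aeval (x i) Y'))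
  (hB : ∀ i, (l i * (k i * (l i * (l i * (k i * k i))))).trace = aeval (x i) B)
  (hB' : ∀ i, (k i * (l i * (k i * (k i * (l i * l i))))).trace = aeval (x i) B')
include h

theorem pow_mod (i : ι) (e : ℕ) : k i ^ e = k i ^ (e % 3) :=
  pow_eq_pow_mod e (by rw [pow_succ, pow_two, (h i).kkk])

/-- Cyclic invariance reduces every word to kᵉlᶠ with e, f < 3, whose nine traces involve only
constants, y and ȳ. The traces β and β̄ enter only through `mul_left`. -/
theorem exists_trace (hm : PolyComb x k l m) :
    ∃ p : MvPolynomial Coord ℂ, ∀ i, (m i).trace = aeval (x i) p := by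
  have hsymm : ∀ i, TriPair (l i) (k i) (aeval (x i) Y') (aeval (x i) Y) := fun i => (h i).symm
  have main : ∀ e f : ℕ, ∃ p : MvPolynomial Coord ℂ, ∀ i,
      (k i ^ e * l i ^ f).trace = aeval (x i) p := by
    intro e f
    simp only [pow_mod hsymm _ f, pow_mod h _ e]
    have he : e % 3 < 3 := Nat.mod_lt _ (by norm_num)
    have hf : f % 3 < 3 := Nat.mod_lt _ (by norm_num)
    generalize e % 3 = e at he
    generalize f % 3 = f at hf
    interval_cases e <;> interval_cases f
    · exact ⟨3, fun i => by simp⟩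
    · exact ⟨0, fun i => by simp [(h i).tr_l]⟩
    · exact ⟨0, fun i => by simp [pow_two, (h i).tr_ll]⟩
    · exact ⟨0, fun i => by simp [(h i).tr_k]⟩
    · exact ⟨1, fun i => by simp [(h i).tr_kl]⟩
    · exact ⟨Y, fun i => by simp [pow_two, (h i).trace_kll]⟩
    · exact ⟨0, fun i => by simp [pow_two, (h i).tr_kk]⟩
    · exact ⟨Y', fun i => by simp [pow_two, (h i).tr_kkl]⟩
    · exact ⟨1, fun i => by simp [pow_two, mul_assoc, (h i).trace_kkll]⟩
  induction hm with
  | kl e f => exact main e f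
  | lk e f =>
    obtain ⟨p, hp⟩ := main f e
    exact ⟨p, fun i => by rw [Matrix.trace_mul_comm, hp]⟩
  | klk f =>
    obtain ⟨p, hp⟩ := main 3 f
    exact ⟨p, fun i => by rw [Matrix.trace_mul_comm, ← mul_assoc, ← pow_succ, hp]⟩
  | lkl e =>
    obtain ⟨p, hp⟩ := main e 3
    exact ⟨p, fun i => by rw [Matrix.trace_mul_comm, ← mul_assoc, ← pow_succ, Matrix.trace_mul_comm,
      hp]⟩
  | add _ _ h1 h2 =>
    obtain ⟨p, hp⟩ := h1
    obtain ⟨q, hq⟩ := h2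
    exact ⟨p + q, fun i => by simp [hp, hq]⟩
  | smul p _ h1 =>
    obtain ⟨q, hq⟩ := h1
    exact ⟨p * q, fun i => by simp [hq]⟩

include hB hB'

/-- With exponents taken modulo 3, each new word collapses by a sandwich rule, except klk²l², which
needs `three_commutator` and hence β, β̄ and division by 3. -/
theorem mul_left (hm : PolyComb x k l m) : PolyComb x k l fun i => k i * m i := by
  have hsymm : ∀ i, TriPair (l i) (k i) (aeval (x i) Y') (aeval (x i) Y) := fun i => (h i).symm
  induction hm with
  | kl e f => simpa only [← mul_assoc, ← pow_succ'] using kl (e + 1) f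
  | lk e f =>
    simp only [pow_mod hsymm _ e, pow_mod h _ f]
    have he : e % 3 < 3 := Nat.mod_lt _ (by norm_num)
    have hf : f % 3 < 3 := Nat.mod_lt _ (by norm_num)
    generalize e % 3 = e at he
    generalize f % 3 = f at hf
    interval_cases f
    · simpa using kl 1 e
    · interval_cases e
      · simpa [pow_two] using kl 2 0
      · convert ((((kl 1 0).add (one.smul Y')).sub (kl 2 1)).sub (lk 1 2)) using 2 with i
        simpa [pow_two, mul_assoc] using (h i).klk
      · convert ((((kl 1 0).smul Y).add one).sub (kl 2 2)).sub (lk 2 2) using 2 with i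
        simpa [pow_two, mul_assoc] using (h i).kllk
    · simpa only [mul_assoc] using klk e
  | klk f =>
    simp only [pow_mod hsymm _ f]
    have hf : f % 3 < 3 := Nat.mod_lt _ (by norm_num)
    generalize f % 3 = f at hf
    interval_cases f
    · convert kl 4 0 using 2 with i
      simp [pow_succ, mul_assoc]
    · convert ((((kl 2 0).smul Y').add one).sub (kl 1 1)).sub (lk 1 1) using 2 with i
      simpa [pow_two, mul_assoc] using (h i).kklkk
    · convert (((kl 2 0).add (one.smul Y)).sub (kl 1 2)).sub (lk 2 1) using 2 with i
      simpa [pow_two, mul_assoc] using (h i).kkllkk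
  | lkl e =>
    simp only [pow_mod h _ e]
    have he : e % 3 < 3 := Nat.mod_lt _ (by norm_num)
    generalize e % 3 = e at he
    interval_cases e
    · convert kl 1 3 using 2 with i
      simp [pow_succ, mul_assoc]
    · convert ((((kl 1 2).add ((kl 0 2).smul Y')).sub (kl 2 0)).sub (lkl 2)) using 2 with i
      have e := congrArg (fun m => m * l i ^ 2) (h i).klk
      simpa [pow_two, mul_assoc, add_mul, sub_mul, (h i).symm.k_cube] using e
    · convert csmul (1 / 3) (((((((((((kl 1 1).csmul 2).add (lk 1 1)).add ((kl 2 2).csmul 2)).add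
        (lk 2 2)).add (one.smul (2 * B' + B))).sub ((lk 1 2).smul Y)).sub
        ((kl 2 1).smul (2 * Y))).add ((kl 1 2).smul Y')).sub ((lk 2 1).smul Y'))) using 2 with i
      have e := (h i).three_commutator (hB i) (hB' i)
      have e2 : (2 : ℂ) = aeval (x i) (2 : MvPolynomial Coord ℂ) := by simp
      simp only [pow_two, mul_assoc, pow_one, map_mul, map_add, ← e2]
      rw [← e, smul_smul]
      norm_num
  | add _ _ h1 h2 => simpa only [mul_add] using h1.add h2
  | smul p _ h1 => simpa only [mul_smul_comm] using h1.smul p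

end PolyComb

/-! ### Trace identities from conjugation by t -/

theorem t_mul_a : t * a * t⁻¹ = a * b := by
  have h : (PresentedGroup.mk relators (FreeGroup.of Gen.t * FreeGroup.of Gen.a *
      (FreeGroup.of Gen.t)⁻¹ * (FreeGroup.of Gen.a * FreeGroup.of Gen.b)⁻¹)) = 1 :=
    PresentedGroup.one_of_mem (by simp [relators])
  rw [map_mul, map_inv, mul_inv_eq_one] at h
  simp only [map_mul, map_inv] at h
  exact h

theorem t_mul_b : t * b * t⁻¹ = b * a * b := by
  have h : (PresentedGroup.mk relators (FreeGroup.of Gen.t * FreeGroup.of Gen.b *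
      (FreeGroup.of Gen.t)⁻¹ * (FreeGroup.of Gen.b * FreeGroup.of Gen.a * FreeGroup.of Gen.b)⁻¹))
      = 1 :=
    PresentedGroup.one_of_mem (by simp [relators])
  rw [map_mul, map_inv, mul_inv_eq_one] at h
  simp only [map_mul, map_inv] at h
  exact h

theorem b_eq : b = a⁻¹ * t * a * t⁻¹ := by
  have h := t_mul_a
  rw [mul_assoc, mul_assoc, ← mul_assoc t, h, inv_mul_cancel_left]

/-- The consequence used below is χ(ta) = χ(t), together with its analogue for inverses. -/
theorem t_eq_conj : t = b * (t * a) * b⁻¹ := by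
  have h := t_mul_b
  have h' := t_mul_a
  rw [mul_assoc b, ← h'] at h
  calc t = t * b * t⁻¹ * t * b⁻¹ := by group
    _ = b * (t * a * t⁻¹) * t * b⁻¹ := by rw [h]
    _ = _ := by group

/-- The matrix of a group element. -/
abbrev mat (ρ : SLRep) (g : Knot) : Mat3 := (ρ g : Matrix (Fin 3) (Fin 3) ℂ)

section trace

variable (ρ : SLRep)

theorem mat_mul (g h : Knot) : mat ρ (g * h) = mat ρ g * mat ρ h := by simp [mat]

theorem mat_inv (g : Knot) : mat ρ g⁻¹ = (mat ρ g).adjugate := by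
  simp [mat, Matrix.SpecialLinearGroup.coe_inv]

theorem charFun_eq (g : Knot) : charFun ρ g = (mat ρ g).trace := rfl

theorem charFun_one : charFun ρ 1 = 3 := by simp [charFun]

theorem charFun_mul_comm (g h : Knot) : charFun ρ (g * h) = charFun ρ (h * g) := by
  simp only [charFun_eq, mat_mul]
  exact Matrix.trace_mul_comm _ _

theorem charFun_conj (g h : Knot) : charFun ρ (g * h * g⁻¹) = charFun ρ h := by
  rw [charFun_mul_comm, inv_mul_cancel_left]

theorem mat_mul_self (g : Knot) :
    mat ρ (g * g) = charFun ρ g • mat ρ g - charFun ρ g⁻¹ • (1 : Mat3) + mat ρ g⁻¹ := by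
  rw [mat_mul, cayley_hamilton_three, ← mat_inv]
  rfl

theorem mat_sandwich (g h : Knot) :
    mat ρ (g * h * g) = charFun ρ (g * h) • mat ρ g + charFun ρ g⁻¹ • mat ρ h
      + charFun ρ h • mat ρ g⁻¹ + (charFun ρ (g⁻¹ * h) - charFun ρ h * charFun ρ g⁻¹) • (1 : Mat3)
      - mat ρ (g⁻¹ * h) - mat ρ (h * g⁻¹) := by
  simp only [charFun_eq, mat_mul, mat_inv]
  exact sandwich _ _

theorem charFun_mul_sq (g h : Knot) :
    charFun ρ (g * (h * h)) =
      charFun ρ h * charFun ρ (g * h) - charFun ρ h⁻¹ * charFun ρ g + charFun ρ (g * h⁻¹) := by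
  simp only [charFun_eq, mat_mul ρ g, mat_mul_self ρ h, mul_add, mul_sub, mul_smul_comm, mul_one,
    Matrix.trace_add, Matrix.trace_sub, Matrix.trace_smul, smul_eq_mul]

theorem charFun_sq (h : Knot) :
    charFun ρ (h * h) = charFun ρ h ^ 2 - 2 * charFun ρ h⁻¹ := by
  have := charFun_mul_sq ρ 1 h
  simp only [one_mul, charFun_one] at this
  linear_combination this

theorem charFun_ab : charFun ρ (a * b) = charFun ρ a := by rw [← t_mul_a, charFun_conj]

theorem charFun_abb : charFun ρ (a * (b * b)) = charFun ρ b := by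
  rw [← mul_assoc, charFun_mul_comm, ← mul_assoc, ← t_mul_b, charFun_conj]

theorem charFun_ab_inv : charFun ρ (a * b⁻¹) = charFun ρ b⁻¹ := by
  rw [← charFun_conj ρ t]
  congr 1
  calc t * (a * b⁻¹) * t⁻¹ = (t * a * t⁻¹) * (t * b * t⁻¹)⁻¹ := by group
    _ = _ := by rw [t_mul_a, t_mul_b]; group

theorem charFun_inv_ab : charFun ρ (a⁻¹ * b⁻¹) = charFun ρ a⁻¹ := by
  rw [charFun_mul_comm, ← mul_inv_rev, ← t_mul_a, show (t * a * t⁻¹)⁻¹ = t * a⁻¹ * t⁻¹ by group,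
    charFun_conj]

theorem charFun_inv_abb : charFun ρ (a⁻¹ * (b⁻¹ * b⁻¹)) = charFun ρ b⁻¹ := by
  have h : b⁻¹ * a⁻¹ * b⁻¹ = t * b⁻¹ * t⁻¹ := by
    rw [show b⁻¹ * a⁻¹ * b⁻¹ = (b * a * b)⁻¹ by group, ← t_mul_b]; group
  rw [← mul_assoc, charFun_mul_comm, ← mul_assoc, h, charFun_conj]

theorem charFun_inv_ab_inv : charFun ρ (a⁻¹ * b) = charFun ρ b := by
  rw [← charFun_conj ρ t]
  rw [show t * (a⁻¹ * b) * t⁻¹ = (t * a * t⁻¹)⁻¹ * (t * b * t⁻¹) by group, t_mul_a, t_mul_b,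
    charFun_mul_comm, show b * a * b * (a * b)⁻¹ = b by group]

/-- Cayley–Hamilton expresses χ(ab²) through χ(ab) and χ(ab⁻¹). Conjugation by t identifies these
three traces with β, α and β̄. -/
theorem alpha_sub_one_mul : (charFun ρ a - 1) * (charFun ρ b - charFun ρ b⁻¹) = 0 := by
  have h := charFun_mul_sq ρ a b
  rw [charFun_abb, charFun_ab, charFun_ab_inv] at h
  linear_combination -h

theorem alpha_inv_sub_one_mul : (charFun ρ a⁻¹ - 1) * (charFun ρ b - charFun ρ b⁻¹) = 0 := by
  have h := charFun_mul_sq ρ a⁻¹ b⁻¹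
  rw [charFun_inv_abb, charFun_inv_ab, inv_inv, charFun_inv_ab_inv] at h
  linear_combination h

end trace

/-! ### Characters with α = ᾱ = 1 -/

/-- The second generator `a⁻¹ t` of the knot group. -/
def el : Knot := a⁻¹ * t

theorem t_eq : t = a * el := by simp [el]

theorem b_eq_el : b = el * a * el⁻¹ * a⁻¹ := by
  rw [b_eq, t_eq]; group

/-- Eliminating b and t turns the second relation into one between the two generators a and `el`. -/
theorem el_relation : a * (el * el) * a = el * (a * a * a) * el := by
  have h := t_mul_b
  rw [b_eq_el, t_eq] at h
  calc a * (el * el) * a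
      = a * el * (el * a * el⁻¹ * a⁻¹) * (a * el)⁻¹ * (a * el * a * el) := by group
    _ = el * a * el⁻¹ * a⁻¹ * a * (el * a * el⁻¹ * a⁻¹) * (a * el * a * el) := by rw [h]
    _ = _ := by group

section unit_trace

variable {ρ : SLRep} (hα : charFun ρ a = 1) (hα' : charFun ρ a⁻¹ = 1)
include hα hα'

/-- Together with `charFun_a_inv_el` this transfers the vanishing of the traces of l and l⁻¹ to k =
al⁻¹ and k⁻¹. -/
theorem charFun_a_el_inv : charFun ρ (a * el⁻¹) = charFun ρ el⁻¹ := by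
  have h := charFun_mul_sq ρ t⁻¹ a
  have e1 : charFun ρ (t⁻¹ * (a * a)) = charFun ρ (a * el⁻¹) := by
    rw [charFun_mul_comm, el, mul_inv_rev, inv_inv, mul_assoc, charFun_mul_comm ρ a]
    simp only [mul_assoc]
  have e2 : charFun ρ (t⁻¹ * a) = charFun ρ el⁻¹ := by rw [el, mul_inv_rev, inv_inv]
  have e3 : charFun ρ (t⁻¹ * a⁻¹) = charFun ρ t⁻¹ := by
    conv_rhs => rw [t_eq_conj, show (b * (t * a) * b⁻¹)⁻¹ = b * (t * a)⁻¹ * b⁻¹ by group,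
      charFun_conj, mul_inv_rev, charFun_mul_comm]
  rw [e1, e2, e3, hα, hα'] at h
  linear_combination h

theorem charFun_a_inv_el : charFun ρ (a⁻¹ * el) = charFun ρ el := by
  have h := charFun_mul_sq ρ t a⁻¹
  have e1 : charFun ρ (t * (a⁻¹ * a⁻¹)) = charFun ρ (a⁻¹ * el) := by
    rw [charFun_mul_comm, el, mul_assoc]
  have e2 : charFun ρ (t * a⁻¹) = charFun ρ el := by rw [el, charFun_mul_comm]
  have e3 : charFun ρ (t * a) = charFun ρ t := by
    conv_rhs => rw [t_eq_conj, charFun_conj]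
  rw [e1, e2, inv_inv, e3, hα, hα'] at h
  linear_combination h

omit hα hα' in
theorem charFun_a_inv_el_inv : charFun ρ (a⁻¹ * el⁻¹) = charFun ρ t⁻¹ := by
  rw [t_eq, mul_inv_rev, charFun_mul_comm]

theorem mat_a_sq : mat ρ (a * a) = mat ρ a - 1 + mat ρ a⁻¹ := by
  rw [mat_mul_self, hα, hα', one_smul, one_smul]

/-- The characteristic polynomial X³ − X² + X − 1 divides X⁴ − 1, so the image of a has fourth power
1. -/
theorem mat_a_cube : mat ρ (a * a * a) = mat ρ a⁻¹ := by
  have h := mat_a_sq hα hα'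
  rw [mat_mul, h, add_mul, sub_mul, ← mat_mul, ← mat_mul, h, inv_mul_cancel, one_mul]
  simp only [mat, map_one, Matrix.SpecialLinearGroup.coe_one]
  abel

theorem mat_aela : mat ρ (a * el * a) = charFun ρ t • mat ρ a + mat ρ el + charFun ρ el • mat ρ a⁻¹
    - mat ρ (a⁻¹ * el) - mat ρ (el * a⁻¹) := by
  rw [mat_sandwich, charFun_a_inv_el hα hα', ← t_eq, hα']
  module

/-- The relation of the knot group, for representations with `χ(a) = χ(a⁻¹) = 1`. -/
theorem linear_relation :
    charFun ρ el • (charFun ρ t • mat ρ a + charFun ρ el • mat ρ a⁻¹ - mat ρ (a⁻¹ * el)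
      - mat ρ (el * a⁻¹)) + charFun ρ el⁻¹ • (1 - mat ρ a⁻¹) = 0 := by
  -- Expanding el² by Cayley–Hamilton and replacing a³ by a⁻¹ leaves only sandwiches, which
  -- `mat_sandwich` makes linear.
  have h := congrArg (mat ρ) el_relation
  rw [mat_mul, mat_mul, mat_mul_self, mat_mul ρ _ el, mat_mul ρ el, mat_a_cube hα hα',
    ← mat_mul, ← mat_mul, mat_sandwich ρ el a⁻¹] at h
  have h1 := mat_aela hα hα'
  have h2 := mat_sandwich ρ a el⁻¹
  have h3 := mat_a_sq hα hα'
  rw [charFun_a_el_inv hα hα', charFun_a_inv_el_inv, hα'] at h2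
  rw [charFun_mul_comm ρ el a⁻¹, charFun_a_inv_el hα hα', charFun_mul_comm ρ el⁻¹,
    charFun_a_inv_el_inv, hα'] at h
  simp only [mul_add, mul_sub, add_mul, sub_mul, mul_smul_comm, smul_mul_assoc, mul_one,
    ← mat_mul] at h
  rw [h1, h2, h3] at h
  linear_combination (norm := module) h

theorem trace_linear_relation (g : Knot) :
    charFun ρ el * (charFun ρ t * charFun ρ (a * g) + charFun ρ el * charFun ρ (a⁻¹ * g)
      - charFun ρ (a⁻¹ * (el * g)) - charFun ρ (el * (a⁻¹ * g)))
      + charFun ρ el⁻¹ * (charFun ρ g - charFun ρ (a⁻¹ * g)) = 0 := by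
  have h := congrArg (fun m => (m * mat ρ g).trace) (linear_relation hα hα')
  simp only [add_mul, sub_mul, smul_mul_assoc, ← mat_mul, one_mul, mul_assoc, zero_mul,
    Matrix.trace_add, Matrix.trace_sub, Matrix.trace_smul, smul_eq_mul, Matrix.trace_zero] at h
  exact h

omit hα hα' in
theorem charFun_commutator : charFun ρ (a⁻¹ * (el * (a * el⁻¹))) = charFun ρ b := by
  rw [charFun_mul_comm, b_eq_el]
  simp only [mul_assoc]

omit hα hα' in
theorem charFun_commutator_inv : charFun ρ (el * (a⁻¹ * (el⁻¹ * a))) = charFun ρ b⁻¹ := by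
  rw [b_eq_el, show (el * a * el⁻¹ * a⁻¹)⁻¹ = a * (el * (a⁻¹ * el⁻¹)) by group, charFun_mul_comm ρ a]
  simp only [mul_assoc]

/-- The linear relation is traced against a·el⁻¹ and el⁻¹·a. The two results differ only in the
commutator term, which is χ(b) in one and χ(b⁻¹) in the other. -/
theorem charFun_el_mul_sub : charFun ρ el * (charFun ρ b - charFun ρ b⁻¹) = 0 := by
  have h1 := trace_linear_relation hα hα' (a * el⁻¹)
  have h2 := trace_linear_relation hα hα' (el⁻¹ * a)
  have e1 : charFun ρ (a * (a * el⁻¹)) = charFun ρ (a * (el⁻¹ * a)) := by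
    rw [charFun_mul_comm, mul_assoc]
  have e2 : charFun ρ (a⁻¹ * (a * el⁻¹)) = charFun ρ (a⁻¹ * (el⁻¹ * a)) := by
    rw [charFun_mul_comm ρ a⁻¹ (el⁻¹ * a)]; congr 1; group
  have e3 : charFun ρ (a⁻¹ * (el * (el⁻¹ * a))) = charFun ρ (el * (a⁻¹ * (a * el⁻¹))) := by
    congr 1; group
  rw [e1, e2, charFun_commutator, charFun_mul_comm ρ a el⁻¹] at h1
  rw [charFun_commutator_inv, e3] at h2
  linear_combination h2 - h1

theorem charFun_b_add :
    charFun ρ b + charFun ρ b⁻¹ = charFun ρ t * charFun ρ t⁻¹ + charFun ρ el * charFun ρ el⁻¹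
      - charFun ρ el * charFun ρ t⁻¹ - charFun ρ t * charFun ρ el⁻¹ - 2 := by
  have h := mat_aela hα hα'
  have h1 := congrArg (fun m => (mat ρ a * m * mat ρ el⁻¹).trace) h
  have h2 := congrArg (fun m => (m * mat ρ el⁻¹).trace) h
  have h3 := congrArg (fun m => (m * mat ρ (el * a * el⁻¹)).trace) (mat_a_sq hα hα')
  have h4 := congrArg (fun m => (m * mat ρ el⁻¹).trace) (mat_a_sq hα hα')
  have e1 : charFun ρ (a⁻¹ * (el * el⁻¹)) = 1 := by rw [mul_inv_cancel, mul_one, hα']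
  have e2 : charFun ρ (el * (a⁻¹ * el⁻¹)) = 1 := by rw [← mul_assoc, charFun_conj, hα']
  have e3 : charFun ρ (el * (a * el⁻¹)) = 1 := by rw [← mul_assoc, charFun_conj, hα]
  have e4 : charFun ρ (a * (el * (a⁻¹ * el⁻¹))) = charFun ρ b⁻¹ := by
    rw [← charFun_commutator_inv, charFun_mul_comm]; simp only [mul_assoc]
  simp only [mul_add, mul_sub, mul_smul_comm, add_mul, sub_mul, smul_mul_assoc, ← mat_mul, one_mul,
    mul_assoc, mul_inv_cancel_left, ← charFun_eq, mul_inv_cancel, mul_one,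
    Matrix.trace_add, Matrix.trace_sub, Matrix.trace_smul, smul_eq_mul, e2, e3, e4,
    hα, hα', charFun_one, charFun_a_el_inv hα hα', charFun_a_inv_el_inv, charFun_commutator]
    at h1 h2 h3 h4
  linear_combination h1 - h3 - h2 + charFun ρ t * h4

theorem charFun_el_inv_sq :
    charFun ρ el⁻¹ ^ 2 - 2 * charFun ρ el = charFun ρ t⁻¹ * charFun ρ el⁻¹ := by
  have h := congrArg (fun g => charFun ρ g⁻¹) el_relation
  have h1 : charFun ρ (a * (el * el) * a)⁻¹ = charFun ρ ((el⁻¹ * el⁻¹) * (a⁻¹ * a⁻¹)) := by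
    rw [show (a * (el * el) * a)⁻¹ = a⁻¹ * ((el⁻¹ * el⁻¹) * a⁻¹) by group, charFun_mul_comm]
    simp only [mul_assoc]
  have h2 : charFun ρ (el * (a * a * a) * el)⁻¹ = charFun ρ (el⁻¹ * el⁻¹ * a) := by
    have e : mat ρ (a * a * a)⁻¹ = mat ρ a := by
      rw [mat_inv, mat_a_cube hα hα', ← mat_inv, inv_inv]
    rw [show (el * (a * a * a) * el)⁻¹ = el⁻¹ * (a * a * a)⁻¹ * el⁻¹ by group, charFun_mul_comm,
      ← mul_assoc, charFun_eq, mat_mul, e, ← mat_mul, charFun_eq]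
  have h3 := charFun_mul_sq ρ (el⁻¹ * el⁻¹) a⁻¹
  have h4 := charFun_mul_sq ρ a⁻¹ el⁻¹
  have h5 := charFun_sq ρ el⁻¹
  simp only [h1, h2] at h
  rw [charFun_a_inv_el_inv, inv_inv, hα', charFun_a_inv_el hα hα', ← charFun_mul_comm] at h4
  rw [h, inv_inv, hα, hα', h4, h5, inv_inv] at h3
  linear_combination h3

/-- With q = χ(el) and q̄ = χ(el⁻¹), the hypothesis and `charFun_b_add` give qq̄ = qȳ + yq̄. The
linear relation traced against el⁻¹ then gives q²q̄ = 0, and q̄ = 0 implies q = 0 by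
`charFun_el_inv_sq`. -/
theorem charFun_el_eq_zero (hs : charFun ρ t * charFun ρ t⁻¹ = charFun ρ b + charFun ρ b⁻¹ + 2) :
    charFun ρ el = 0 := by
  have h1 := charFun_b_add hα hα'
  have h2 := charFun_el_inv_sq hα hα'
  have h3 := trace_linear_relation hα hα' el⁻¹
  rw [charFun_a_el_inv hα hα', charFun_a_inv_el_inv, mul_inv_cancel, mul_one, hα', ← mul_assoc,
    charFun_conj, hα'] at h3
  have h4 : charFun ρ el ^ 2 * charFun ρ el⁻¹ = 0 := by
    linear_combination h3 - h2 - charFun ρ el * (h1 + hs)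
  rcases mul_eq_zero.mp h4 with h4 | h4
  · exact pow_eq_zero_iff (two_ne_zero) |>.mp h4
  · rw [h4] at h2
    linear_combination (-1 / 2 : ℂ) * h2

theorem charFun_el_inv_eq_zero (hq : charFun ρ el = 0) : charFun ρ el⁻¹ = 0 := by
  have h := trace_linear_relation hα hα' 1
  simp only [hq, mul_one, hα', charFun_one] at h
  linear_combination (1 / 2 : ℂ) * h

end unit_trace

/-! ### Representations given by pairs of order three -/

/-- The representation `ρ` is given by the pair `k, l` of matrices of order three. -/
structure GivenBy (ρ : SLRep) (k l : Mat3) : Prop where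
  mat_a : mat ρ a = k * l
  mat_b : mat ρ b = l * (k * (l * (l * (k * k))))
  mat_t : mat ρ t = k * (l * l)

theorem triPair_of_charFun_el {ρ : SLRep} (hα : charFun ρ a = 1) (hα' : charFun ρ a⁻¹ = 1)
    (hq : charFun ρ el = 0) :
    TriPair (mat ρ (a * el⁻¹)) (mat ρ el) (charFun ρ t) (charFun ρ t⁻¹) ∧
      GivenBy ρ (mat ρ (a * el⁻¹)) (mat ρ el) := by
  have hq' := charFun_el_inv_eq_zero hα hα' hq
  have hl : mat ρ (el * el) = mat ρ el⁻¹ := by rw [mat_mul_self, hq, hq']; simp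
  have tk : charFun ρ (a * el⁻¹) = 0 := by rw [charFun_a_el_inv hα hα', hq']
  have tk' : charFun ρ (a * el⁻¹)⁻¹ = 0 := by
    rw [mul_inv_rev, inv_inv, charFun_mul_comm, charFun_a_inv_el hα hα', hq]
  have hk : mat ρ (a * el⁻¹ * (a * el⁻¹)) = mat ρ (a * el⁻¹)⁻¹ := by
    rw [mat_mul_self, tk, tk']; simp
  have hm1 : mat ρ 1 = 1 := by simp [mat]
  have hl' : mat ρ (el⁻¹ * el⁻¹) = mat ρ el := by
    rw [mat_mul_self, inv_inv, hq, hq']; simp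
  constructor
  · constructor
    · rw [← mat_mul, hk, ← mat_mul, inv_mul_cancel, hm1]
    · rw [← mat_mul, hl, ← mat_mul, inv_mul_cancel, hm1]
    · exact tk
    · rw [← mat_mul, hk]; exact tk'
    · exact hq
    · rw [← mat_mul, hl]; exact hq'
    · rw [← mat_mul, inv_mul_cancel_right]; exact hα
    · rw [mul_assoc, ← mat_mul, hl, ← mat_mul, mul_assoc, mat_mul, hl', ← mat_mul, ← t_eq]; rfl
    · rw [← mat_mul, hk, ← mat_mul, mul_inv_rev, inv_inv, ← charFun_eq, charFun_mul_comm,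
        ← mul_assoc, charFun_eq, mat_mul, hl, ← mat_mul, ← mul_inv_rev, ← t_eq]
      rfl
    · rw [mul_assoc, ← mat_mul, hk, ← mat_mul, hl, ← mat_mul, mul_inv_rev, inv_inv]
      rw [← charFun_eq, charFun_conj, hα']
  · constructor
    · rw [← mat_mul, inv_mul_cancel_right]
    · rw [b_eq_el, ← mat_mul ρ (a * el⁻¹) (a * el⁻¹), hk, ← mul_assoc (mat ρ el) (mat ρ el),
        ← mat_mul ρ el el, hl]
      simp only [← mat_mul]
      exact congrArg (mat ρ) (by group)
    · rw [← mat_mul, hl, ← mat_mul, mul_assoc, mat_mul, hl', ← mat_mul, ← t_eq]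

theorem mat_inv_eq {ρ : SLRep} {x : Knot} {m : Mat3} (hm : m * mat ρ x = 1) : mat ρ x⁻¹ = m := by
  have e : mat ρ x * mat ρ x⁻¹ = 1 := by rw [← mat_mul, mul_inv_cancel]; simp [mat]
  exact (left_inv_eq_right_inv hm e).symm

namespace GivenBy

variable {ρ : SLRep} {k l : Mat3} {y y' : ℂ} (g : GivenBy ρ k l) (h : TriPair k l y y')
include g h

theorem mat_a_inv : mat ρ a⁻¹ = l * (l * (k * k)) :=
  mat_inv_eq (by
    rw [g.mat_a]; simp only [mul_assoc, h.k_cancel, h.symm.k_cube])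

theorem mat_b_inv : mat ρ b⁻¹ = k * (l * (k * (k * (l * l)))) :=
  mat_inv_eq (by
    rw [g.mat_b]; simp only [mul_assoc, h.k_cancel, h.symm.k_cancel, h.k_cube])

theorem mat_t_inv : mat ρ t⁻¹ = l * (k * k) :=
  mat_inv_eq (by
    rw [g.mat_t]; simp only [mul_assoc, h.k_cancel, h.symm.k_cube])

/-- The coordinates of a representation that is given by a pair of matrices of order three satisfy
the equations of `V₁`. -/
theorem aeval_eq_zero (p : MvPolynomial Coord ℂ) (hp : p ∈ eqsV1) :
    aeval (fun c : Coord => charFun ρ c.elt) p = 0 := by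
  have ha : charFun ρ a = 1 := by rw [charFun_eq, g.mat_a, h.tr_kl]
  have ha' : charFun ρ a⁻¹ = 1 := by rw [charFun_eq, g.mat_a_inv h, h.symm.trace_kkll]
  have ht : charFun ρ t = y := by rw [charFun_eq, g.mat_t, h.trace_kll]
  have ht' : charFun ρ t⁻¹ = y' := by rw [charFun_eq, g.mat_t_inv h, h.trace_lkk]
  have hs := h.trace_add_trace
  have hm := h.trace_mul_trace
  rw [← g.mat_b, ← g.mat_b_inv h, ← charFun_eq, ← charFun_eq] at hs hm
  have hη : charFun ρ (a * b * a⁻¹ * b⁻¹)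
      = y ^ 3 - 3 * y * y' + 3 := by
    rw [← h.trace_kll_cube, charFun_eq]
    simp only [mat_mul, g.mat_a_inv h, g.mat_b_inv h, g.mat_a, g.mat_b]
    simp only [mul_assoc, h.k_cancel, h.symm.k_cancel]
  have hz : charFun ρ (t * a⁻¹ * t * a) = y' := by
    rw [← h.trace_kkl, charFun_eq]
    simp only [mat_mul, g.mat_a_inv h, g.mat_t, g.mat_a]
    simp only [mul_assoc, h.k_cancel, h.symm.k_cancel]
  have hz' : charFun ρ (a⁻¹ * t⁻¹ * a * t⁻¹) = y := by
    rw [← h.symm.trace_kkl, charFun_eq]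
    simp only [mat_mul, g.mat_a_inv h, g.mat_t_inv h, g.mat_a]
    simp only [mul_assoc, h.k_cancel, h.symm.k_cancel, h.k_cube, mul_one]
  simp only [eqsV1, Set.mem_insert_iff, Set.mem_singleton_iff] at hp
  rcases hp with rfl | rfl | rfl | rfl | rfl | rfl | rfl <;>
    simp only [map_sub, map_add, map_mul, map_pow, map_one, map_ofNat, aeval_X, Coord.elt, ha, ha',
      ht, ht', hη, hz, hz']
  · ring
  · ring
  · linear_combination -hs
  · linear_combination -hm - 5 * hs
  · linear_combination 3 * hs
  · ring
  · ring

end GivenBy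

/-- A representation whose character satisfies the equations of `V₁` is given by a pair of matrices
of order three. -/
theorem exists_triPair {ρ : SLRep}
    (h : ∀ p ∈ eqsV1, aeval (fun c : Coord => charFun ρ c.elt) p = 0) :
    ∃ k l, TriPair k l (charFun ρ t) (charFun ρ t⁻¹) ∧ GivenBy ρ k l := by
  have h1 := h (X .α - 1) (by simp [eqsV1])
  have h2 := h (X .α' - 1) (by simp [eqsV1])
  have h3 := h (X .y * X .y' - (X .β + X .β' + 2)) (by simp [eqsV1])
  simp only [map_sub, map_add, map_mul, map_one, map_ofNat, aeval_X, Coord.elt] at h1 h2 h3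
  have hα := sub_eq_zero.mp h1
  have hα' := sub_eq_zero.mp h2
  exact ⟨_, _, triPair_of_charFun_el hα hα' (charFun_el_eq_zero hα hα' (sub_eq_zero.mp h3))⟩

/-- Away from `β = β̄` every character satisfies the equations of `V₁`. -/
theorem aeval_eq_zero_of_ne {ρ : SLRep} (h : charFun ρ b ≠ charFun ρ b⁻¹)
    (p : MvPolynomial Coord ℂ) (hp : p ∈ eqsV1) :
    aeval (fun c : Coord => charFun ρ c.elt) p = 0 := by
  have h' := sub_ne_zero.mpr h
  have hα := sub_eq_zero.mp ((mul_eq_zero.mp (alpha_sub_one_mul ρ)).resolve_right h')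
  have hα' := sub_eq_zero.mp ((mul_eq_zero.mp (alpha_inv_sub_one_mul ρ)).resolve_right h')
  have hq := (mul_eq_zero.mp (charFun_el_mul_sub hα hα')).resolve_right h'
  obtain ⟨h1, h2⟩ := triPair_of_charFun_el hα hα' hq
  exact h2.aeval_eq_zero h1 p hp

/-! ### Traces on V₁ as polynomials in the coordinates -/

section polynomial

/-- Representations whose characters satisfy the equations of `V₁`. -/
abbrev V1Rep : Type := {ρ : SLRep // ∀ p ∈ eqsV1, aeval (fun c : Coord => charFun ρ c.elt) p = 0}

/-- On `V₁` every trace is a polynomial in the coordinates. -/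
theorem exists_polynomial_charFun (g : Knot) :
    ∃ P : MvPolynomial Coord ℂ, ∀ ρ : V1Rep,
      charFun ρ.1 g = aeval (fun c : Coord => charFun ρ.1 c.elt) P := by
  -- One polynomial must serve all representations at once, so k and l are families indexed by them.
  choose k l hkl using fun ρ : V1Rep => exists_triPair ρ.2
  set x : V1Rep → Coord → ℂ := fun ρ c => charFun ρ.1 c.elt with hx
  have ht : ∀ ρ : V1Rep, TriPair (k ρ) (l ρ) (aeval (x ρ) (X .y : MvPolynomial Coord ℂ))
      (aeval (x ρ) (X .y' : MvPolynomial Coord ℂ)) := fun ρ => by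
    simpa [hx, Coord.elt] using (hkl ρ).1
  have hB : ∀ ρ, (l ρ * (k ρ * (l ρ * (l ρ * (k ρ * k ρ))))).trace =
      aeval (x ρ) (X .β : MvPolynomial Coord ℂ) := fun ρ => by
    simp [hx, Coord.elt, charFun_eq, (hkl ρ).2.mat_b]
  have hB' : ∀ ρ, (k ρ * (l ρ * (k ρ * (k ρ * (l ρ * l ρ))))).trace =
      aeval (x ρ) (X .β' : MvPolynomial Coord ℂ) := fun ρ => by
    simp [hx, Coord.elt, charFun_eq, (hkl ρ).2.mat_b_inv (hkl ρ).1]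
  have mk : ∀ m, PolyComb x k l m → PolyComb x k l fun ρ => k ρ * m ρ := fun m hm =>
    hm.mul_left ht hB hB'
  have ml : ∀ m, PolyComb x k l m → PolyComb x k l fun ρ => l ρ * m ρ := fun m hm =>
    (hm.symm.mul_left (fun ρ => (ht ρ).symm) hB' hB).symm
  suffices H : ∀ m, PolyComb x k l m → PolyComb x k l fun ρ => mat ρ.1 g * m ρ by
    obtain ⟨P, hP⟩ := (H _ PolyComb.one).exists_trace ht
    refine ⟨P, fun ρ => ?_⟩
    have := hP ρ
    rw [mul_one] at this
    exact this
  obtain ⟨w, rfl⟩ := PresentedGroup.mk_surjective relators g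
  induction w using FreeGroup.induction_on with
  | C1 => intro m hm; simpa only [map_one, mat, Matrix.SpecialLinearGroup.coe_one, one_mul] using hm
  | of c =>
    intro m hm
    cases c
    · convert mk _ (ml _ hm) using 2 with ρ
      rw [← mul_assoc, ← (hkl ρ).2.mat_a]; rfl
    · convert ml _ (mk _ (ml _ (ml _ (mk _ (mk _ hm))))) using 2 with ρ
      simp only [← mul_assoc]
      have := (hkl ρ).2.mat_b
      simp only [← mul_assoc] at this
      rw [← this]; rfl
    · convert mk _ (ml _ (ml _ hm)) using 2 with ρ
      simp only [← mul_assoc]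
      have := (hkl ρ).2.mat_t
      simp only [← mul_assoc] at this
      rw [← this]; rfl
  | inv_of c _ =>
    intro m hm
    cases c
    · convert ml _ (ml _ (mk _ (mk _ hm))) using 2 with ρ
      simp only [← mul_assoc]
      have := (hkl ρ).2.mat_a_inv (hkl ρ).1
      simp only [← mul_assoc] at this
      rw [← this]; rfl
    · convert mk _ (ml _ (mk _ (mk _ (ml _ (ml _ hm))))) using 2 with ρ
      simp only [← mul_assoc]
      have := (hkl ρ).2.mat_b_inv (hkl ρ).1
      simp only [← mul_assoc] at this
      rw [← this]; rfl
    · convert ml _ (mk _ (mk _ hm)) using 2 with ρ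
      simp only [← mul_assoc]
      have := (hkl ρ).2.mat_t_inv (hkl ρ).1
      simp only [← mul_assoc] at this
      rw [← this]; rfl
  | mul u v hu hv =>
    intro m hm
    convert hu _ (hv _ hm) using 2 with ρ
    rw [map_mul, mat_mul, mul_assoc]

end polynomial

/-! ### Realising every solution by a representation -/

theorem TriPair.of_adjugate {k l : Mat3} {y y' : ℂ} (dk : k.det = 1) (dl : l.det = 1)
    (tk : k.trace = 0) (tk' : k.adjugate.trace = 0) (tl : l.trace = 0) (tl' : l.adjugate.trace = 0)
    (h1 : (k * l).trace = 1) (h2 : (k * l.adjugate).trace = y) (h3 : (k.adjugate * l).trace = y')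
    (h4 : (k.adjugate * l.adjugate).trace = 1) : TriPair k l y y' := by
  have hk : k * k = k.adjugate := by
    rw [cayley_hamilton_three, tk, tk']; simp
  have hl : l * l = l.adjugate := by
    rw [cayley_hamilton_three, tl, tl']; simp
  constructor
  · rw [hk, Matrix.adjugate_mul, dk, one_smul]
  · rw [hl, Matrix.adjugate_mul, dl, one_smul]
  · exact tk
  · rw [hk, tk']
  · exact tl
  · rw [hl, tl']
  · exact h1
  · rw [mul_assoc, hl, h2]
  · rw [hk, h3]
  · rw [mul_assoc, hl, hk, h4]

theorem TriPair.exists_givenBy {k l : Mat3} {y y' : ℂ} (h : TriPair k l y y') (dk : k.det = 1)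
    (dl : l.det = 1) : ∃ ρ : SLRep, GivenBy ρ k l := by
  let K : Matrix.SpecialLinearGroup (Fin 3) ℂ := ⟨k, dk⟩
  let L : Matrix.SpecialLinearGroup (Fin 3) ℂ := ⟨l, dl⟩
  have hK : (K : Mat3) = k := rfl
  have hL : (L : Mat3) = l := rfl
  let f : Gen → Matrix.SpecialLinearGroup (Fin 3) ℂ := fun c =>
    match c with
    | .a => K * L
    | .b => L * (K * (L * (L * (K * K))))
    | .t => K * (L * L)
  have hf : ∀ r ∈ relators, FreeGroup.lift f r = 1 := by
    intro r hr
    rcases hr with rfl | rfl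
    · simp only [map_mul, map_inv, FreeGroup.lift_apply_of, f]
      rw [mul_inv_eq_one, mul_inv_eq_iff_eq_mul]
      apply Subtype.ext
      simp only [Matrix.SpecialLinearGroup.coe_mul, hK, hL]
      simp only [mul_assoc, h.k_cancel, h.symm.k_cancel]
    · simp only [map_mul, map_inv, FreeGroup.lift_apply_of, f]
      rw [mul_inv_eq_one, mul_inv_eq_iff_eq_mul]
      apply Subtype.ext
      simp only [Matrix.SpecialLinearGroup.coe_mul, hK, hL]
      simp only [mul_assoc, h.k_cancel, h.symm.k_cancel]
      rw [h.conj_relation]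
  refine ⟨PresentedGroup.toGroup hf, ?_, ?_, ?_⟩
  · rw [mat, a, PresentedGroup.toGroup.of]; rfl
  · rw [mat, b, PresentedGroup.toGroup.of]; rfl
  · rw [mat, t, PresentedGroup.toGroup.of]; rfl

theorem exists_quadratic_root {p q c : ℂ} (hc : c ≠ 0) (h : p ≠ 0 ∨ q ≠ 0) :
    ∃ m : ℂ, m ≠ 0 ∧ p * m ^ 2 + q * m + c = 0 := by
  suffices ∃ m : ℂ, p * m ^ 2 + q * m + c = 0 by
    obtain ⟨m, hm⟩ := this
    refine ⟨m, ?_, hm⟩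
    rintro rfl
    exact hc (by simpa using hm)
  by_cases hp : p = 0
  · have hq : q ≠ 0 := h.resolve_left (by simpa using hp)
    refine ⟨-c / q, ?_⟩
    rw [hp]
    field_simp
    ring
  · obtain ⟨s, hs⟩ := IsAlgClosed.exists_pow_nat_eq (q ^ 2 - 4 * p * c) (n := 2) (by norm_num)
    refine ⟨(-q + s) / (2 * p), ?_⟩
    field_simp
    linear_combination hs

/-- For the matrices of `exists_triPair_of_traces` the equations say, in order, tr k⁻¹l = ȳ, det l =
1 (equivalently tr k⁻¹l⁻¹ = 1), tr l⁻¹ = 0 and tr kl⁻¹ = y. -/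
theorem exists_parameters (y y' : ℂ) : ∃ m n q r : ℂ, r + q = y' ∧ n ^ 2 + q * m = -1 ∧
    q + m ^ 2 + n * r = 0 ∧ -n * m + q * r - m = y := by
  by_cases hD : y' ^ 2 - 2 * y = 0
  · have hI := Complex.I_sq
    refine ⟨0, Complex.I, y' * (1 - Complex.I) / 2, y' * (1 + Complex.I) / 2, ?_, ?_, ?_, ?_⟩
    · ring
    · linear_combination hI
    · linear_combination y' / 2 * hI
    · linear_combination hD / 2 - y' ^ 2 / 4 * hI
  -- With n = 1 + cm, and with q and r taken from the second and first equations, this c makes the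
  -- other two follow from a single quadratic in m.
  · obtain ⟨c, hc⟩ : ∃ c, c * (y' ^ 2 - 2 * y) = y * y' - 4 :=
      ⟨(y * y' - 4) / (y' ^ 2 - 2 * y), div_mul_cancel₀ _ hD⟩
    obtain ⟨m, hm, hr⟩ := exists_quadratic_root (p := y - c * y' + 2 * c ^ 2) (q := 4 * c) (c := 4)
      (by norm_num) (by
        by_contra! hcon
        obtain ⟨h1, h2⟩ := hcon
        have hc0 : c = 0 := by simpa using h2
        rw [hc0] at h1 hc
        have : y = 0 := by linear_combination h1
        rw [this] at hc
        norm_num at hc)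
    have hq : ∀ q, q = -(1 + (1 + c * m) ^ 2) / m → q * m = -(1 + (1 + c * m) ^ 2) := by
      rintro q rfl
      field_simp
    generalize hq' : -(1 + (1 + c * m) ^ 2) / m = q at hq
    have hqm := hq q rfl
    have h3 : q + m ^ 2 + (1 + c * m) * (y' - q) = 0 := by
      refine mul_left_cancel₀ hm ?_
      have hA : 2 * (2 * m ^ 2 + -(c * m) * y * m + (1 + (1 + c * m) ^ 2) * y') = 0 := by
        linear_combination y' * hr + m ^ 2 * hc
      linear_combination m / 4 * hA + c * m / 2 * hr + (-(c * m)) * hqm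
    refine ⟨m, 1 + c * m, q, y' - q, by ring, by linear_combination hqm, h3, ?_⟩
    refine mul_left_cancel₀ (pow_ne_zero 2 hm) ?_
    linear_combination (-1 : ℂ) * hr - (2 + c * m) * m * h3 +
      (m * y' + (2 + c * m) * (-(c * m)) - q * m + (1 + (1 + c * m) ^ 2)) * hqm

/-- Here k is a cyclic permutation matrix, and the shape of l makes tr l = 0 and tr kl = 1
automatic. -/
theorem exists_triPair_of_traces (y y' : ℂ) :
    ∃ k l : Mat3, TriPair k l y y' ∧ k.det = 1 ∧ l.det = 1 := by
  obtain ⟨m, n, q, r, h1, h2, h3, h4⟩ := exists_parameters y y'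
  have dk : (!![0, 0, 1; 1, 0, 0; 0, 1, 0] : Mat3).det = 1 := by simp [Matrix.det_fin_three]
  have dl : (!![0, -n, q; 0, m, n; 1, r, -m] : Mat3).det = 1 := by
    simp [Matrix.det_fin_three]
    linear_combination -h2
  refine ⟨!![0, 0, 1; 1, 0, 0; 0, 1, 0], !![0, -n, q; 0, m, n; 1, r, -m],
    .of_adjugate dk dl ?_ ?_ ?_ ?_ ?_ ?_ ?_ ?_, dk, dl⟩ <;>
    simp [Matrix.adjugate_fin_three_of, Matrix.trace_fin_three]
  · linear_combination -h3
  · linear_combination h4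
  · linear_combination h1
  · linear_combination -h2

theorem trace_commutator_rotate (k l : Mat3) :
    (k * (k * (l * (l * (k * l))))).trace = (k * (l * (k * (k * (l * l))))).trace := by
  have r1 := Matrix.trace_mul_comm (k * (k * (l * (l * k)))) l
  have r2 := Matrix.trace_mul_comm (l * (k * (k * (l * l)))) k
  simp only [mul_assoc] at r1 r2
  rw [r1, r2]

/-- Every solution of the equations is realised by a representation. -/
theorem exists_rep_of_solution {β β' y y' : ℂ} (h1 : y * y' = β + β' + 2)
    (h2 : y ^ 3 + y' ^ 3 = β * β' + 5 * β + 5 * β' + 5) :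
    ∃ (ρ : SLRep) (k l : Mat3), TriPair k l y y' ∧ GivenBy ρ k l ∧ charFun ρ b = β := by
  obtain ⟨k, l, h, dk, dl⟩ := exists_triPair_of_traces y y'
  have hs := h.trace_add_trace
  have hp := h.trace_mul_trace
  -- The two commutator traces have the same sum and product as β and β̄, so β is one of them; if it
  -- is the wrong one, transposition swaps them.
  have hz : ((l * (k * (l * (l * (k * k))))).trace - β) *
      ((k * (l * (k * (k * (l * l))))).trace - β) = 0 := by
    linear_combination hp - β * hs + h2 + (-5 - β) * h1
  rcases mul_eq_zero.mp hz with hz | hz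
  · obtain ⟨ρ, hρ⟩ := h.exists_givenBy dk dl
    exact ⟨ρ, k, l, h, hρ, by rw [charFun_eq, hρ.mat_b, sub_eq_zero.mp hz]⟩
  · obtain ⟨ρ, hρ⟩ := h.transpose.exists_givenBy (by rw [Matrix.det_transpose, dk])
      (by rw [Matrix.det_transpose, dl])
    refine ⟨ρ, _, _, h.transpose, hρ, ?_⟩
    rw [charFun_eq, hρ.mat_b]
    simp only [← Matrix.transpose_mul, mul_assoc, Matrix.trace_transpose]
    rw [trace_commutator_rotate, sub_eq_zero.mp hz]

/-! ### Reducible representations and eigenvectors -/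

section irreducible

variable {G W : Type*} [Group G] [AddCommGroup W] [Module ℂ W] {σ : Representation ℂ G W}

theorem exists_subrepresentation [Nontrivial W] (h : ¬ σ.IsIrreducible) :
    ∃ U : Subrepresentation σ, U.toSubmodule ≠ ⊥ ∧ U.toSubmodule ≠ ⊤ := by
  by_contra! hcon
  have : Nontrivial (Subrepresentation σ) := by
    refine ⟨⊥, ⊤, fun he => ?_⟩
    have h' := congrArg Subrepresentation.toSubmodule he
    exact bot_ne_top (α := Submodule ℂ W) h'
  refine h ⟨fun U => ?_⟩
  by_cases hU : U.toSubmodule = ⊥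
  · exact Or.inl (Subrepresentation.toSubmodule_injective hU)
  · exact Or.inr (Subrepresentation.toSubmodule_injective (hcon U hU))

theorem exists_common_eigenvector {U : Subrepresentation σ}
    (hU : Module.finrank ℂ U.toSubmodule = 1) : ∃ v ≠ 0, v ∈ U.toSubmodule ∧
      ∀ g, ∃ c : ℂ, σ g v = c • v := by
  obtain ⟨v, hv, h⟩ := finrank_eq_one_iff'.mp hU
  refine ⟨v, fun h0 => hv (Subtype.ext h0), v.2, fun g => ?_⟩
  obtain ⟨c, hc⟩ := h ⟨σ g v, U.apply_mem_toSubmodule g v.2⟩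
  exact ⟨c, (congrArg Subtype.val hc).symm⟩

theorem irreducible_of_finrank_two (h2 : Module.finrank ℂ W = 2)
    (h : ∀ v : W, (∀ g, ∃ c : ℂ, σ g v = c • v) → v = 0) : σ.IsIrreducible := by
  by_contra hσ
  have : FiniteDimensional ℂ W := Module.finite_of_finrank_pos (by omega)
  have : Nontrivial W := Module.nontrivial_of_finrank_pos (R := ℂ) (by omega)
  obtain ⟨U, hb, ht⟩ := exists_subrepresentation hσ
  have h1 := Submodule.finrank_lt ht
  have h3 := Submodule.one_le_finrank_iff.mpr hb
  obtain ⟨v, hv, -, hv'⟩ := exists_common_eigenvector (U := U) (by omega)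
  exact hv (h v hv')

end irreducible

/-- An invariant line is spanned by an eigenvector. An invariant plane is the kernel of a
functional, which is an eigenvector of the transposes. -/
theorem exists_eigenvector_of_not_irred {ρ : SLRep} (h : ¬ Irred ρ) : ∃ v : Fin 3 → ℂ, v ≠ 0 ∧
    ((∀ g, ∃ c : ℂ, (mat ρ g).mulVec v = c • v) ∨
      ∀ g, ∃ c : ℂ, (mat ρ g).transpose.mulVec v = c • v) := by
  obtain ⟨U, hb, ht⟩ := exists_subrepresentation h
  have h1 := Submodule.finrank_lt ht
  have h2 := Submodule.one_le_finrank_iff.mpr hb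
  rw [Module.finrank_fin_fun] at h1
  by_cases hU : Module.finrank ℂ U.toSubmodule = 1
  · obtain ⟨v, hv, -, hv'⟩ := exists_common_eigenvector hU
    refine ⟨v, hv, Or.inl fun g => ?_⟩
    obtain ⟨c, hc⟩ := hv' g
    exact ⟨c, hc⟩
  · obtain ⟨f, hf, hfU⟩ := Submodule.exists_le_ker_of_lt_top _ (lt_top_iff_ne_top.mpr ht)
    have h3 := Module.Dual.finrank_ker_add_one_of_ne_zero hf
    rw [Module.finrank_fin_fun] at h3
    have hker : U.toSubmodule = LinearMap.ker f :=
      Submodule.eq_of_le_of_finrank_eq hfU (by omega)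
    obtain ⟨x, hx⟩ : ∃ x, f x ≠ 0 := by
      by_contra! hcon
      exact hf (LinearMap.ext hcon)
    have key : ∀ g, ∃ c : ℂ, ∀ u, f ((mat ρ g).mulVec u) = c * f u := by
      intro g
      refine ⟨f ((mat ρ g).mulVec x) / f x, fun u => ?_⟩
      have hu : f x • u - f u • x ∈ U.toSubmodule := by
        rw [hker, LinearMap.mem_ker]
        simp [mul_comm]
      have hu' := U.apply_mem_toSubmodule g hu
      rw [hker, LinearMap.mem_ker] at hu'
      have hu2 : f ((mat ρ g).mulVec (f x • u - f u • x)) = 0 := hu'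
      rw [Matrix.mulVec_sub, Matrix.mulVec_smul, Matrix.mulVec_smul, map_sub, map_smul, map_smul,
        smul_eq_mul, smul_eq_mul] at hu2
      field_simp
      linear_combination hu2
    refine ⟨fun i => f (Pi.single i 1), fun h0 => hf ?_, Or.inr fun g => ?_⟩
    · refine LinearMap.pi_ext' fun i => LinearMap.ext_ring ?_
      simpa using congrFun h0 i
    · obtain ⟨c, hc⟩ := key g
      refine ⟨c, funext fun i => ?_⟩
      have := hc (Pi.single i 1)
      rw [Pi.smul_apply, smul_eq_mul, ← this]
      have e : (mat ρ g).mulVec (Pi.single i 1) = ∑ j, mat ρ g j i • Pi.single j (1 : ℂ) := by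
        ext j
        simp [Pi.single_apply]
      rw [e, map_sum]
      simp [Matrix.mulVec, dotProduct]

namespace GivenBy

variable {ρ : SLRep} {k l : Mat3} {y y' : ℂ} (g : GivenBy ρ k l) (h : TriPair k l y y')
include g h

theorem mat_k : mat ρ (a * t⁻¹ * a) = k := by
  rw [mat_mul, mat_mul, g.mat_t_inv h, g.mat_a]
  simp only [mul_assoc, h.k_cancel, h.symm.k_cube, mul_one]

theorem mat_l : mat ρ (a⁻¹ * t) = l := by
  rw [mat_mul, g.mat_a_inv h, g.mat_t]
  simp only [mul_assoc, h.k_cancel, h.symm.k_cancel]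

theorem of_not_irred (hρ : ¬ Irred ρ) : ∃ κ : ℂ, κ ^ 3 = 1 ∧ y' = 2 * κ ∧ y = 2 * κ ^ 2 := by
  obtain ⟨v, hv, H | H⟩ := exists_eigenvector_of_not_irred hρ
  · obtain ⟨κ, hκ⟩ := H (a * t⁻¹ * a)
    obtain ⟨μ, hμ⟩ := H (a⁻¹ * t)
    rw [g.mat_k h] at hκ
    rw [g.mat_l h] at hμ
    exact ⟨κ, h.of_common_eigenvector hv hκ hμ⟩
  · obtain ⟨κ, hκ⟩ := H (a * t⁻¹ * a)
    obtain ⟨μ, hμ⟩ := H (a⁻¹ * t)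
    rw [g.mat_k h] at hκ
    rw [g.mat_l h] at hμ
    exact ⟨κ, h.transpose.of_common_eigenvector hv hκ hμ⟩

end GivenBy

/-! ### Partially reducible representations -/

/-- Block diagonal matrices with blocks of sizes one and two. -/
def IsBlock (M : Mat3) : Prop := M 0 1 = 0 ∧ M 0 2 = 0 ∧ M 1 0 = 0 ∧ M 2 0 = 0

theorem IsBlock.mul {M N : Mat3} (hM : IsBlock M) (hN : IsBlock N) : IsBlock (M * N) := by
  obtain ⟨h1, h2, h3, h4⟩ := hM
  obtain ⟨h5, h6, h7, h8⟩ := hN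
  refine ⟨?_, ?_, ?_, ?_⟩ <;> simp [Matrix.mul_apply, Fin.sum_univ_three, *]

theorem GivenBy.isBlock {ρ : SLRep} {k l : Mat3} {y y' : ℂ} (g : GivenBy ρ k l)
    (h : TriPair k l y y') (hk : IsBlock k) (hl : IsBlock l) (x : Knot) : IsBlock (mat ρ x) := by
  obtain ⟨w, rfl⟩ := PresentedGroup.mk_surjective relators x
  induction w using FreeGroup.induction_on with
  | C1 => simp [mat, IsBlock]
  | of c =>
    cases c
    · exact g.mat_a ▸ hk.mul hl
    · exact g.mat_b ▸ hl.mul (hk.mul (hl.mul (hl.mul (hk.mul hk))))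
    · exact g.mat_t ▸ hk.mul (hl.mul hl)
  | inv_of c _ =>
    cases c
    · exact g.mat_a_inv h ▸ hl.mul (hl.mul (hk.mul hk))
    · exact g.mat_b_inv h ▸ hk.mul (hl.mul (hk.mul (hk.mul (hl.mul hl))))
    · exact g.mat_t_inv h ▸ hl.mul (hk.mul hk)
  | mul u v hu hv =>
    rw [map_mul, mat_mul]
    exact hu.mul hv

/-- For every cube root of unity `w` there is a partially reducible representation with
`χ(t) = 2 w` and `χ(t⁻¹) = 2 w²`. -/
theorem exists_partiallyReducible {w : ℂ} (hw : w ^ 3 = 1) : ∃ (ρ : SLRep) (k l : Mat3),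
    TriPair k l (2 * w) (2 * w ^ 2) ∧ GivenBy ρ k l ∧ PartiallyReducible ρ := by
  have hI := Complex.I_sq
  have hw0 : w ≠ 0 := by rintro rfl; norm_num at hw
  -- On the line the eigenvalues w² and w have product 1, as `klkl` requires. The 2 × 2 blocks are
  -- w² and w times matrices of determinant 1 and trace −1, chosen so that their product has trace
  -- 0.
  obtain ⟨k, hk⟩ : ∃ k : Mat3, k = !![w ^ 2, 0, 0; 0, 0, -w ^ 2; 0, w ^ 2, -w ^ 2] := ⟨_, rfl⟩
  obtain ⟨l, hl⟩ : ∃ l : Mat3, l = !![w, 0, 0; 0, -w, w * Complex.I; 0, w * Complex.I, 0] :=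
    ⟨_, rfl⟩
  have dk : k.det = 1 := by
    simp [hk, Matrix.det_fin_three]
    linear_combination (w ^ 3 + 1) * hw
  have dl : l.det = 1 := by
    simp [hl, Matrix.det_fin_three]
    linear_combination hw - w ^ 3 * hI
  have h : TriPair k l (2 * w) (2 * w ^ 2) := by
    refine .of_adjugate dk dl ?_ ?_ ?_ ?_ ?_ ?_ ?_ ?_ <;>
      simp [hk, hl, Matrix.adjugate_fin_three_of, Matrix.trace_fin_three]
    · linear_combination (-w ^ 2) * hI
    · linear_combination hw
    · linear_combination (2 * w) * hw - w ^ 4 * hI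
    · linear_combination (2 * w ^ 2) * hw
    · linear_combination (w ^ 3 + 1) * hw - w ^ 6 * hI
  obtain ⟨ρ, g⟩ := h.exists_givenBy dk dl
  have hblock := g.isBlock h (by simp [IsBlock, hk]) (by simp [IsBlock, hl])
  refine ⟨ρ, k, l, h, g, ?_⟩
  let P : Subrepresentation (linRep ρ) :=
    { toSubmodule := LinearMap.ker (LinearMap.proj (R := ℂ) (φ := fun _ : Fin 3 => ℂ) 0)
      apply_mem_toSubmodule := fun x v hv => by
        have hv0 : v 0 = 0 := hv
        have hb := hblock x
        change (mat ρ x).mulVec v 0 = 0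
        simp [Matrix.mulVec, dotProduct, Fin.sum_univ_three, hb.1, hb.2.1, hv0] }
  let Q : Subrepresentation (linRep ρ) :=
    { toSubmodule := ℂ ∙ (Pi.single 0 1 : Fin 3 → ℂ)
      apply_mem_toSubmodule := fun x v hv => by
        obtain ⟨c, rfl⟩ := Submodule.mem_span_singleton.mp hv
        have hb := hblock x
        refine Submodule.mem_span_singleton.mpr ⟨c * mat ρ x 0 0, ?_⟩
        change _ = (mat ρ x).mulVec _
        ext i
        fin_cases i <;> simp [Matrix.mulVec, dotProduct, Fin.sum_univ_three, hb.2.2.1, hb.2.2.2,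
          mul_comm] }
  have hP : ∀ v, v ∈ P.toSubmodule ↔ v 0 = 0 := fun v => Iff.rfl
  have hQ1 : Module.finrank ℂ Q.toSubmodule = 1 :=
    finrank_span_singleton (by simp)
  have hc : IsCompl Q.toSubmodule P.toSubmodule := by
    constructor
    · rw [Submodule.disjoint_def]
      intro v hv hv'
      obtain ⟨c, rfl⟩ := Submodule.mem_span_singleton.mp hv
      have : c = 0 := by simpa using (hP _).mp hv'
      rw [this, zero_smul]
    · rw [codisjoint_iff, Submodule.eq_top_iff']
      intro v
      refine Submodule.mem_sup.mpr ⟨v 0 • Pi.single 0 1, Submodule.smul_mem _ _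
        (Submodule.mem_span_singleton_self _), v - v 0 • Pi.single 0 1, ?_, by simp⟩
      rw [hP]
      simp
  have hP2 : Module.finrank ℂ P.toSubmodule = 2 := by
    have := Submodule.finrank_add_eq_of_isCompl hc
    rw [hQ1, Module.finrank_fin_fun] at this
    omega
  refine ⟨Q, P, hc, hQ1, hP2, irreducible_of_finrank_two hP2 fun v hv => ?_⟩
  have hev : ∀ x, ∃ c : ℂ, (mat ρ x).mulVec v.1 = c • v.1 := fun x => by
    obtain ⟨c, hc⟩ := hv x
    exact ⟨c, congrArg Subtype.val hc⟩
  obtain ⟨κ, hκ⟩ := hev (a * t⁻¹ * a)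
  obtain ⟨μ, hμ⟩ := hev (a⁻¹ * t)
  rw [g.mat_k h] at hκ
  rw [g.mat_l h] at hμ
  by_contra hv0
  obtain ⟨-, h2, -⟩ := h.of_common_eigenvector (fun h0 => hv0 (Subtype.ext h0)) hκ hμ
  -- An eigenvector in the plane would have k-eigenvalue w², but the block of k is w² times a matrix
  -- without eigenvalue 1.
  have hκw : κ = w ^ 2 := by linear_combination -h2 / 2
  have e0 : v.1 0 = 0 := v.2
  have e1 := congrFun hκ 1
  have e2 := congrFun hκ 2
  simp [hk, hκw, Matrix.mulVec, dotProduct, Fin.sum_univ_three] at e1 e2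
  have hw2 : w ^ 2 ≠ 0 := pow_ne_zero 2 hw0
  have e3 : v.1 2 = 0 := by
    refine mul_left_cancel₀ hw2 ?_
    linear_combination (-1 / 3 : ℂ) * (e1 + e2)
  have e4 : v.1 1 = 0 := by
    refine mul_left_cancel₀ hw2 ?_
    linear_combination -e1 - w ^ 2 * e3
  refine hv0 (Subtype.ext (funext fun i => ?_))
  fin_cases i
  · exact e0
  · exact e4
  · exact e3

/-! ### The ideal of the equations is prime -/

theorem eqsV1_iff (x : Coord → ℂ) : (∀ p ∈ eqsV1, aeval x p = 0) ↔
    x .α = 1 ∧ x .α' = 1 ∧ x .y * x .y' = x .β + x .β' + 2 ∧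
      x .y ^ 3 + x .y' ^ 3 = x .β * x .β' + 5 * x .β + 5 * x .β' + 5 ∧
      x .η = x .y ^ 3 - 3 * (x .β + x .β' + 1) ∧ x .z = x .y' ∧ x .z' = x .y := by
  simp only [eqsV1, Set.mem_insert_iff, Set.mem_singleton_iff, forall_eq_or_imp, forall_eq, map_sub,
    map_add, map_mul, map_pow, map_one, map_ofNat, aeval_X, sub_eq_zero]

/-- The quadratic polynomial over `ℂ[y, ȳ]` with roots `β` and `β̄`. -/
def betaPoly : Polynomial (MvPolynomial (Fin 2) ℂ) :=
  Polynomial.X ^ 2 - Polynomial.C (X 0 * X 1 - 2) * Polynomial.X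
    + Polynomial.C (X 0 ^ 3 + X 1 ^ 3 - 5 * X 0 * X 1 + 5)

theorem betaPoly_monic : betaPoly.Monic := by
  unfold betaPoly; monicity!

theorem betaPoly_natDegree : betaPoly.natDegree = 2 := by
  unfold betaPoly; compute_degree!

theorem eval₂_betaPoly {S : Type*} [CommRing S] (i : MvPolynomial (Fin 2) ℂ →+* S) (x : S) :
    betaPoly.eval₂ i x = x ^ 2 - (i (X 0) * i (X 1) - 2) * x
      + (i (X 0) ^ 3 + i (X 1) ^ 3 - 5 * i (X 0) * i (X 1) + 5) := by
  simp only [betaPoly, Polynomial.eval₂_add, Polynomial.eval₂_sub, Polynomial.eval₂_mul,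
    Polynomial.eval₂_pow, Polynomial.eval₂_X, Polynomial.eval₂_C, map_add, map_sub, map_mul,
    map_pow, map_ofNat, Polynomial.eval₂_ofNat]

/-- A factorisation would need a root. At ȳ = 0 a root g gives (g + 1)² = −(y³ + 4), which has odd
degree. -/
theorem betaPoly_irreducible : Irreducible betaPoly := by
  rw [betaPoly_monic.irreducible_iff_roots_eq_zero_of_degree_le_three (by rw [betaPoly_natDegree])
    (by rw [betaPoly_natDegree]; norm_num), Multiset.eq_zero_iff_forall_notMem]
  intro g hg
  have h1 := (Polynomial.mem_roots'.mp hg).2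
  have h2 := congrArg (aeval (![Polynomial.X, 0] : Fin 2 → Polynomial ℂ)) (show _ = _ from h1)
  simp [betaPoly] at h2
  set q := aeval (![Polynomial.X, 0] : Fin 2 → Polynomial ℂ) g with hq
  have h3 : (q + 1) ^ 2 = -(Polynomial.X ^ 3 + Polynomial.C 4) := by
    rw [show (Polynomial.C 4 : Polynomial ℂ) = 4 from rfl]
    linear_combination h2
  have h4 := congrArg Polynomial.natDegree h3
  rw [Polynomial.natDegree_pow, Polynomial.natDegree_neg, Polynomial.natDegree_X_pow_add_C] at h4
  omega

/-- The coordinate ring of `V₁`. -/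
abbrev V1Ring : Type := AdjoinRoot betaPoly

instance : IsDomain V1Ring := AdjoinRoot.isDomain_of_prime betaPoly_irreducible.prime

/-- The coordinates as elements of the coordinate ring. -/
def genericPoint : Coord → V1Ring
  | .α => 1
  | .α' => 1
  | .β => AdjoinRoot.root betaPoly
  | .β' => AdjoinRoot.of betaPoly (X 0 * X 1 - 2) - AdjoinRoot.root betaPoly
  | .η => AdjoinRoot.of betaPoly (X 0 ^ 3 - 3 * (X 0 * X 1 - 1))
  | .y => AdjoinRoot.of betaPoly (X 0)
  | .y' => AdjoinRoot.of betaPoly (X 1)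
  | .z => AdjoinRoot.of betaPoly (X 1)
  | .z' => AdjoinRoot.of betaPoly (X 0)

/-- The equations eliminate every coordinate except y, ȳ, β and leave `betaPoly` as the only
relation; ψ sends the generic point back to the coordinate classes. -/
theorem ker_aeval_genericPoint :
    RingHom.ker (aeval (R := ℂ) genericPoint).toRingHom = Ideal.span eqsV1 := by
  apply le_antisymm
  · let Q := MvPolynomial Coord ℂ ⧸ Ideal.span eqsV1
    let π : MvPolynomial Coord ℂ →ₐ[ℂ] Q := Ideal.Quotient.mkₐ ℂ _
    have hπ : ∀ p ∈ eqsV1, π p = 0 := fun p hp =>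
      Ideal.Quotient.eq_zero_iff_mem.mpr (Ideal.subset_span hp)
    simp only [eqsV1, Set.mem_insert_iff, Set.mem_singleton_iff, forall_eq_or_imp, forall_eq,
      map_sub, map_add, map_mul, map_pow, map_one, map_ofNat] at hπ
    obtain ⟨h1, h2, h3, h4, h5, h6, h7⟩ := hπ
    let ψ : V1Ring →ₐ[ℂ] Q := AdjoinRoot.liftAlgHom betaPoly
      (aeval ![π (X .y), π (X .y')]) (π (X .β)) (by
        simp only [eval₂_betaPoly, RingHom.coe_coe, aeval_X, Matrix.cons_val_zero,
          Matrix.cons_val_one]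
        linear_combination h4 - (5 + π (X .β)) * h3)
    have key : ψ.comp (aeval genericPoint) = π := by
      refine MvPolynomial.algHom_ext fun c => ?_
      cases c <;> simp [genericPoint, ψ]
      · linear_combination -h1
      · linear_combination -h2
      · linear_combination h3
      · linear_combination -h5 - 3 * h3
      · linear_combination -h6
      · linear_combination -h7
    intro p hp
    have hp' : aeval genericPoint p = 0 := hp
    rw [← Ideal.Quotient.eq_zero_iff_mem]
    change π p = 0
    rw [← key, AlgHom.comp_apply, hp', map_zero]
  · rw [Ideal.span_le]
    intro p hp
    change aeval genericPoint p = 0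
    have hr := AdjoinRoot.eval₂_root betaPoly
    rw [eval₂_betaPoly] at hr
    simp only [eqsV1, Set.mem_insert_iff, Set.mem_singleton_iff] at hp
    rcases hp with rfl | rfl | rfl | rfl | rfl | rfl | rfl <;>
      simp only [genericPoint, map_sub, map_add, map_mul, map_pow, map_one, map_ofNat, aeval_X]
    · ring
    · ring
    · ring
    · linear_combination hr
    · ring
    · ring
    · ring

instance span_eqsV1_isPrime : (Ideal.span eqsV1).IsPrime := by
  rw [← ker_aeval_genericPoint]
  exact RingHom.ker_isPrime _

instance : Finite Coord := by
  refine Finite.of_surjective (fun n : Fin 9 => ![Coord.α, .α', .β, .β', .η, .y, .y', .z, .z'] n) ?_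
  intro c
  cases c
  exacts [⟨0, rfl⟩, ⟨1, rfl⟩, ⟨2, rfl⟩, ⟨3, rfl⟩, ⟨4, rfl⟩, ⟨5, rfl⟩, ⟨6, rfl⟩, ⟨7, rfl⟩, ⟨8, rfl⟩]

theorem vanishingIdeal_solutions :
    vanishingIdeal ℂ {x : Coord → ℂ | ∀ p ∈ eqsV1, aeval x p = 0} = Ideal.span eqsV1 := by
  have h := IsPrime.vanishingIdeal_zeroLocus (K := ℂ) (Ideal.span eqsV1)
  rwa [zeroLocus_span] at h

/-! ### V₁ as an irreducible component -/

/-- The set of characters whose coordinates satisfy the equations. -/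
def V1 : Set CharVar := {χ | ∀ p ∈ eqsV1, aeval (coords χ) p = 0}

/-- The character of a representation, as a point of the variety of characters. -/
def character (ρ : SLRep) : CharVar := ⟨charFun ρ, ρ, rfl⟩

theorem exists_character (χ : CharVar) : ∃ ρ, χ = character ρ := by
  obtain ⟨f, ρ, rfl⟩ := χ
  exact ⟨ρ, rfl⟩

theorem val_character (ρ : SLRep) : (character ρ).val = charFun ρ := rfl

theorem val_injective {χ χ' : CharVar} (h : χ.val = χ'.val) : χ = χ' := Subtype.ext h

/-- On `V₁` every regular function is a polynomial in the coordinates. -/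
theorem exists_polynomial (p : MvPolynomial Knot ℂ) : ∃ P : MvPolynomial Coord ℂ,
    ∀ χ ∈ V1, aeval χ.val p = aeval (coords χ) P := by
  choose P hP using exists_polynomial_charFun
  refine ⟨bind₁ P p, fun χ hχ => ?_⟩
  obtain ⟨ρ, rfl⟩ := exists_character χ
  rw [aeval_bind₁]
  congr 2
  funext g
  exact hP g ⟨ρ, hχ⟩

theorem coords_injOn : Set.InjOn coords V1 := by
  intro χ hχ χ' hχ' h
  refine val_injective (funext fun g => ?_)
  obtain ⟨P, hP⟩ := exists_polynomial (X g)
  have h1 := hP χ hχ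
  have h2 := hP χ' hχ'
  rw [aeval_X] at h1 h2
  rw [h1, h2, h]

theorem GivenBy.character_mem {ρ : SLRep} {k l : Mat3} {y y' : ℂ} (g : GivenBy ρ k l)
    (h : TriPair k l y y') : character ρ ∈ V1 := fun p hp => g.aeval_eq_zero h p hp

theorem GivenBy.coords_y {ρ : SLRep} {k l : Mat3} {y y' : ℂ} (g : GivenBy ρ k l)
    (h : TriPair k l y y') : coords (character ρ) .y = y ∧ coords (character ρ) .y' = y' := by
  constructor
  · change charFun ρ t = y
    rw [charFun_eq, g.mat_t, h.trace_kll]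
  · change charFun ρ t⁻¹ = y'
    rw [charFun_eq, g.mat_t_inv h, h.trace_lkk]

/-- Points of `V₁` are determined by `β`, `y` and `ȳ`. -/
theorem eq_of_solutions {x x' : Coord → ℂ} (hx : ∀ p ∈ eqsV1, aeval x p = 0)
    (hx' : ∀ p ∈ eqsV1, aeval x' p = 0) (hβ : x .β = x' .β) (hy : x .y = x' .y)
    (hy' : x .y' = x' .y') : x = x' := by
  obtain ⟨h1, h2, h3, -, h5, h6, h7⟩ := (eqsV1_iff x).mp hx
  obtain ⟨k1, k2, k3, -, k5, k6, k7⟩ := (eqsV1_iff x').mp hx'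
  rw [hy, hy', hβ] at h3
  have hβ' : x .β' = x' .β' := by linear_combination k3 - h3
  rw [hy, hβ, hβ'] at h5
  funext c
  cases c
  · rw [h1, k1]
  · rw [h2, k2]
  · exact hβ
  · exact hβ'
  · rw [h5, k5]
  · exact hy
  · exact hy'
  · rw [h6, k6, hy']
  · rw [h7, k7, hy]

theorem coords_bijOn :
    Set.BijOn coords V1 {x | ∀ p ∈ eqsV1, aeval x p = 0} := by
  refine ⟨fun χ hχ => hχ, coords_injOn, fun x hx => ?_⟩
  obtain ⟨-, -, h3, h4, -⟩ := (eqsV1_iff x).mp hx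
  obtain ⟨ρ, k, l, h, g, hβ⟩ := exists_rep_of_solution h3 h4
  exact ⟨character ρ, g.character_mem h,
    eq_of_solutions (g.character_mem h) hx hβ (g.coords_y h).1 (g.coords_y h).2⟩

theorem vanishingIdeal_coords : vanishingIdeal ℂ (coords '' V1) = Ideal.span eqsV1 := by
  rw [coords_bijOn.image_eq, vanishingIdeal_solutions]

/-- The point of `V₁` with given values of `β`, `y` and `ȳ`. -/
theorem exists_mem_V1 {β β' y y' : ℂ} (h1 : y * y' = β + β' + 2)
    (h2 : y ^ 3 + y' ^ 3 = β * β' + 5 * β + 5 * β' + 5) :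
    ∃ χ ∈ V1, coords χ .β = β ∧ coords χ .β' = β' ∧ coords χ .y = y ∧ coords χ .y' = y' := by
  obtain ⟨ρ, k, l, h, g, hβ⟩ := exists_rep_of_solution h1 h2
  have hV := g.character_mem h
  obtain ⟨-, -, h3, -⟩ := (eqsV1_iff _).mp hV
  obtain ⟨hy, hy'⟩ := g.coords_y h
  have hβ2 : coords (character ρ) .β = β := hβ
  rw [hy, hy', hβ2] at h3
  exact ⟨character ρ, hV, hβ2, by linear_combination h1 - h3, hy, hy'⟩

theorem isClosed_V1 : IsClosed V1 := by
  rw [CharVar.isClosed_iff]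
  refine ⟨rename Coord.elt '' eqsV1, ?_⟩
  ext χ
  simp only [V1, CharVar.zeros, Set.mem_ofPred_eq, Set.forall_mem_image, aeval_rename]
  rfl

/-- Regular functions on V₁ are polynomials in the coordinates, so irreducibility is primality of
the ideal of the equations. -/
theorem isIrreducible_V1 : IsIrreducible V1 := by
  constructor
  -- At y = ȳ = 0 the equations read β + β̄ = −2 and ββ̄ = 5.
  · obtain ⟨χ, hχ, -⟩ := exists_mem_V1 (β := -1 + 2 * Complex.I) (β' := -1 - 2 * Complex.I) (y := 0)
      (y' := 0) (by ring) (by linear_combination 4 * Complex.I_sq)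
    exact ⟨χ, hχ⟩
  · rw [isPreirreducible_iff_isClosed_union_isClosed]
    intro Z₁ Z₂ h₁ h₂ hV
    obtain ⟨S₁, rfl⟩ := (CharVar.isClosed_iff _).mp h₁
    obtain ⟨S₂, rfl⟩ := (CharVar.isClosed_iff _).mp h₂
    by_contra! hcon
    obtain ⟨hn₁, hn₂⟩ := hcon
    obtain ⟨χ₁, hχ₁, hz₁⟩ := Set.not_subset.mp hn₁
    obtain ⟨χ₂, hχ₂, hz₂⟩ := Set.not_subset.mp hn₂
    simp only [CharVar.zeros, Set.mem_ofPred_eq, not_forall] at hz₁ hz₂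
    obtain ⟨p₁, hp₁, hv₁⟩ := hz₁
    obtain ⟨p₂, hp₂, hv₂⟩ := hz₂
    obtain ⟨P₁, hP₁⟩ := exists_polynomial p₁
    obtain ⟨P₂, hP₂⟩ := exists_polynomial p₂
    have hmem : P₁ * P₂ ∈ Ideal.span eqsV1 := by
      rw [← vanishingIdeal_coords, mem_vanishingIdeal_iff]
      rintro _ ⟨χ, hχ, rfl⟩
      rw [map_mul, ← hP₁ χ hχ, ← hP₂ χ hχ]
      rcases hV hχ with h | h
      · rw [h p₁ hp₁, zero_mul]
      · rw [h p₂ hp₂, mul_zero]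
    rw [← vanishingIdeal_coords] at hmem
    have : (vanishingIdeal ℂ (coords '' V1)).IsPrime := by
      rw [vanishingIdeal_coords]; infer_instance
    rcases this.mem_or_mem hmem with h | h
    · exact hv₁ (by rw [hP₁ χ₁ hχ₁]; exact h _ ⟨χ₁, hχ₁, rfl⟩)
    · exact hv₂ (by rw [hP₂ χ₂ hχ₂]; exact h _ ⟨χ₂, hχ₂, rfl⟩)

theorem isClosed_zeros_singleton (p : MvPolynomial Knot ℂ) :
    IsClosed {χ : CharVar | aeval χ.val p = 0} := by
  rw [CharVar.isClosed_iff]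
  exact ⟨{p}, by ext χ; simp [CharVar.zeros]⟩

/-- Reducible characters in `V₁`. -/
theorem reducible_coords {ρ : SLRep} (hV : character ρ ∈ V1) (hρ : ¬ Irred ρ) :
    ∃ w : ℂ, w ^ 3 = 1 ∧ coords (character ρ) .y = 2 * w ∧ coords (character ρ) .y' = 2 * w ^ 2 := by
  obtain ⟨k, l, h, g⟩ := exists_triPair hV
  obtain ⟨κ, hκ, h1, h2⟩ := g.of_not_irred h hρ
  refine ⟨κ ^ 2, by rw [← pow_mul, mul_comm, pow_mul, hκ, one_pow], h2, ?_⟩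
  change charFun ρ t⁻¹ = _
  rw [h1]
  linear_combination (-2 * κ) * hκ

theorem beta_eq_one {x : Coord → ℂ} (hx : ∀ p ∈ eqsV1, aeval x p = 0) {w : ℂ} (hw : w ^ 3 = 1)
    (hy : x .y = 2 * w) (hy' : x .y' = 2 * w ^ 2) : x .β = 1 ∧ x .β' = 1 := by
  obtain ⟨-, -, h3, h4, -⟩ := (eqsV1_iff x).mp hx
  rw [hy, hy'] at h3 h4
  have hs : x .β + x .β' = 2 := by linear_combination 4 * hw - h3
  have hz : (x .β - 1) ^ 2 = 0 := by
    linear_combination h4 + (x .β + 5) * hs - (16 + 8 * w ^ 3) * hw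
  have hβ := sub_eq_zero.mp (pow_eq_zero_iff two_ne_zero |>.mp hz)
  exact ⟨hβ, by linear_combination hs - hβ⟩

/-- Reducible characters in V₁ satisfy y³ = 8. Since V₁ is irreducible and has a point with y = 0,
the irreducible characters are dense in it. -/
theorem V1_subset_closure : V1 ⊆ closure Xirr := by
  have hsub : V1 ⊆ closure Xirr ∪ {χ : CharVar | aeval χ.val (X t ^ 3 - 8 : MvPolynomial Knot ℂ) = 0} := by
    intro χ hχ
    obtain ⟨ρ, rfl⟩ := exists_character χ
    by_cases hρ : Irred ρ
    · exact Or.inl (subset_closure ⟨ρ, hρ, rfl⟩)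
    · obtain ⟨w, hw, hy, -⟩ := reducible_coords hχ hρ
      have hy : charFun ρ t = 2 * w := hy
      refine Or.inr ?_
      simp only [Set.mem_ofPred_eq, map_sub, map_pow, aeval_X, map_ofNat, val_character, hy]
      linear_combination 8 * hw
  rcases isPreirreducible_iff_isClosed_union_isClosed.mp isIrreducible_V1.2 _ _ isClosed_closure
    (isClosed_zeros_singleton _) hsub with h | h
  · exact h
  · obtain ⟨χ, hχ, -, -, hy, -⟩ := exists_mem_V1 (β := -1 + 2 * Complex.I)
      (β' := -1 - 2 * Complex.I) (y := 0) (y' := 0) (by ring)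
      (by linear_combination 4 * Complex.I_sq)
    have h0 := h hχ
    have hy : χ.val t = 0 := hy
    simp only [Set.mem_ofPred_eq, map_sub, map_pow, aeval_X, map_ofNat, hy] at h0
    norm_num at h0

/-- An irreducible set on which `β - β̄` does not vanish identically is contained in `V₁`. -/
theorem subset_V1 {Z : Set CharVar} (hZ : IsIrreducible Z)
    (h : ∃ χ ∈ Z, coords χ .β ≠ coords χ .β') : Z ⊆ V1 := by
  have hsub : Z ⊆ V1 ∪ {χ : CharVar | aeval χ.val (X b - X b⁻¹ : MvPolynomial Knot ℂ) = 0} := by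
    intro χ _
    obtain ⟨ρ, rfl⟩ := exists_character χ
    by_cases hρ : charFun ρ b = charFun ρ b⁻¹
    · refine Or.inr ?_
      simp only [Set.mem_ofPred_eq, map_sub, aeval_X, val_character, hρ, sub_self]
    · exact Or.inl fun p hp => aeval_eq_zero_of_ne hρ p hp
  rcases isPreirreducible_iff_isClosed_union_isClosed.mp hZ.2 _ _ isClosed_V1
    (isClosed_zeros_singleton _) hsub with h' | h'
  · exact h'
  · obtain ⟨χ, hχ, hne⟩ := h
    have h0 := h' hχ
    simp only [Set.mem_ofPred_eq, map_sub, aeval_X] at h0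
    exact absurd (sub_eq_zero.mp h0) hne

theorem isIrrComponent_V1 : IsIrrComponent V1 := by
  refine ⟨⟨isIrreducible_V1, V1_subset_closure⟩, fun Z hZ hVZ => subset_V1 hZ.1 ?_⟩
  obtain ⟨χ, hχ, hβ, hβ', -⟩ := exists_mem_V1 (β := -1 + 2 * Complex.I)
    (β' := -1 - 2 * Complex.I) (y := 0) (y' := 0) (by ring) (by linear_combination 4 * Complex.I_sq)
  refine ⟨χ, hVZ hχ, ?_⟩
  rw [hβ, hβ']
  intro h
  exact Complex.I_ne_zero (by linear_combination h / 4)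

theorem exists_y (β β' : ℂ) : ∃ y y' : ℂ, y * y' = β + β' + 2 ∧
    y ^ 3 + y' ^ 3 = β * β' + 5 * β + 5 * β' + 5 := by
  set s := β + β' + 2
  set c := β * β' + 5 * β + 5 * β' + 5
  obtain ⟨d, hd⟩ := IsAlgClosed.exists_pow_nat_eq (c ^ 2 - 4 * s ^ 3) (n := 2) (by norm_num)
  -- T stands for y³: the numbers y³ and ȳ³ have sum c and product s³. A nonzero root allows ȳ =
  -- s/y; if both roots vanish, then s = c = 0.
  have main : ∀ T : ℂ, T ≠ 0 → T ^ 2 - c * T + s ^ 3 = 0 →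
      ∃ y y' : ℂ, y * y' = s ∧ y ^ 3 + y' ^ 3 = c := by
    intro T hT h
    obtain ⟨y, hy⟩ := IsAlgClosed.exists_pow_nat_eq T (n := 3) (by norm_num)
    have hy0 : y ≠ 0 := by rintro rfl; exact hT (by rw [← hy]; ring)
    refine ⟨y, s / y, by field_simp, ?_⟩
    rw [← hy] at h
    field_simp
    linear_combination h
  by_cases h1 : (c + d) / 2 = 0
  · by_cases h2 : (c - d) / 2 = 0
    · have hc : c = 0 := by linear_combination h1 + h2
      have hd0 : d = 0 := by linear_combination h1 - h2
      have hs : s ^ 3 = 0 := by rw [hc, hd0] at hd; linear_combination hd / 4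
      have hs0 : s = 0 := pow_eq_zero_iff (three_ne_zero) |>.mp hs
      exact ⟨0, 0, by rw [hs0]; ring, by rw [hc]; ring⟩
    · exact main _ h2 (by linear_combination hd / 4)
  · exact main _ h1 (by linear_combination hd / 4)

theorem fibreProj_image_V1 : fibreProj '' V1 = U1 := by
  ext x
  constructor
  · rintro ⟨χ, hχ, rfl⟩
    obtain ⟨h1, h2, -⟩ := (eqsV1_iff _).mp hχ
    exact ⟨h1, h2⟩
  · rintro ⟨h0, h1⟩
    obtain ⟨y, y', hy1, hy2⟩ := exists_y (x 2) (x 3)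
    obtain ⟨χ, hχ, hβ, hβ', -⟩ := exists_mem_V1 hy1 hy2
    obtain ⟨k1, k2, -⟩ := (eqsV1_iff _).mp hχ
    refine ⟨χ, hχ, funext fun i => ?_⟩
    fin_cases i
    · exact k1.trans h0.symm
    · exact k2.trans h1.symm
    · exact hβ
    · exact hβ'

theorem zeroLocus_vanishingIdeal_U1 : zeroLocus ℂ (vanishingIdeal ℂ U1) = U1 := by
  refine Set.Subset.antisymm (fun x hx => ?_) (zeroLocus_vanishingIdeal_le _)
  have h0 := hx (X 0 - 1) (fun z hz => by simp [hz.1])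
  have h1 := hx (X 1 - 1) (fun z hz => by simp [hz.2])
  simp only [map_sub, aeval_X, map_one, sub_eq_zero] at h0 h1
  exact ⟨h0, h1⟩

theorem isV1_V1 : IsV1 V1 :=
  ⟨isIrrComponent_V1, by rw [fibreProj_image_V1, zeroLocus_vanishingIdeal_U1]⟩

/-- If β = β̄ on all of V, this would persist on the Zariski closure of its image, but U₁ contains
(1, 1, 0, 1). -/
theorem eq_V1_of_isV1 {V : Set CharVar} (h : IsV1 V) : V = V1 := by
  have hsub : V ⊆ V1 := by
    refine subset_V1 h.1.prop.1 ?_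
    by_contra! hcon
    have hmem : (X 2 - X 3 : MvPolynomial (Fin 4) ℂ) ∈ vanishingIdeal ℂ (fibreProj '' V) := by
      rintro _ ⟨χ, hχ, rfl⟩
      simp only [map_sub, aeval_X, sub_eq_zero]
      exact hcon χ hχ
    have hp : (![1, 1, 0, 1] : Fin 4 → ℂ) ∈ zeroLocus ℂ (vanishingIdeal ℂ (fibreProj '' V)) := by
      rw [h.2]
      exact ⟨rfl, rfl⟩
    have h0 := hp _ hmem
    simp at h0
  exact Set.Subset.antisymm hsub (h.1.le_of_ge isIrrComponent_V1.prop hsub)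

/-! ### Reducible characters in V₁ -/

theorem coords8_of_reducible {χ : CharVar} (hχ : χ ∈ V1) {w : ℂ} (hw : w ^ 3 = 1)
    (hy : coords χ .y = 2 * w) (hy' : coords χ .y' = 2 * w ^ 2) :
    coords8 χ = centreAct w ![2, 2, 2, 2, 1, 1, 1, 1] := by
  obtain ⟨h1, h2, -, -, -, h6, h7⟩ := (eqsV1_iff _).mp hχ
  obtain ⟨hβ, hβ'⟩ := beta_eq_one hχ hw hy hy'
  rw [coords8, h1, h2, hβ, hβ', h6, h7, hy, hy']
  funext i
  fin_cases i <;> simp [centreAct, mul_comm]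

theorem PartiallyReducible.not_irred {ρ : SLRep} (h : PartiallyReducible ρ) : ¬ Irred ρ := by
  obtain ⟨L, P, -, hL, -, -⟩ := h
  intro hρ
  rcases hρ.eq_bot_or_eq_top L with h | h
  · rw [h] at hL
    change Module.finrank ℂ (⊥ : Submodule ℂ (Fin 3 → ℂ)) = 1 at hL
    simp at hL
  · rw [h] at hL
    change Module.finrank ℂ (⊤ : Submodule ℂ (Fin 3 → ℂ)) = 1 at hL
    simp at hL

/-- The partially reducible characters of `V₁`. -/
theorem exists_mem_Xpr {w : ℂ} (hw : w ^ 3 = 1) : ∃ χ ∈ V1 ∩ Xred, χ ∈ Xpr ∧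
    coords χ .y = 2 * w ∧ coords χ .y' = 2 * w ^ 2 := by
  obtain ⟨ρ, k, l, h, g, hρ⟩ := exists_partiallyReducible hw
  exact ⟨character ρ, ⟨g.character_mem h, ρ, hρ.not_irred, rfl⟩, ⟨ρ, hρ, rfl⟩, g.coords_y h⟩

theorem reducible_of_mem {χ : CharVar} (hχ : χ ∈ V1 ∩ Xred) :
    ∃ w : ℂ, w ^ 3 = 1 ∧ coords χ .y = 2 * w ∧ coords χ .y' = 2 * w ^ 2 := by
  obtain ⟨hV, ρ, hρ, h⟩ := hχ
  obtain rfl : χ = character ρ := val_injective h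
  exact reducible_coords hV hρ

theorem coords8_image :
    coords8 '' (V1 ∩ Xred) =
      (fun ω => centreAct ω ![2, 2, 2, 2, 1, 1, 1, 1]) '' {ω : ℂ | ω ^ 3 = 1} := by
  ext x
  constructor
  · rintro ⟨χ, hχ, rfl⟩
    obtain ⟨w, hw, hy, hy'⟩ := reducible_of_mem hχ
    exact ⟨w, hw, (coords8_of_reducible hχ.1 hw hy hy').symm⟩
  · rintro ⟨w, hw, rfl⟩
    obtain ⟨χ, hχ, -, hy, hy'⟩ := exists_mem_Xpr hw
    exact ⟨χ, hχ, coords8_of_reducible hχ.1 hw hy hy'⟩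

/-- A given reducible representation need not be a direct sum, but its coordinates agree with those
of an explicit partially reducible one, so injectivity of the coordinates gives equal characters. -/
theorem V1_inter_Xred_subset : V1 ∩ Xred ⊆ Xpr := by
  intro χ hχ
  obtain ⟨w, hw, hy, hy'⟩ := reducible_of_mem hχ
  obtain ⟨χ', hχ', hpr, k1, k2⟩ := exists_mem_Xpr hw
  have hβ := (beta_eq_one hχ.1 hw hy hy').1.trans (beta_eq_one hχ'.1 hw k1 k2).1.symm
  have := coords_injOn hχ.1 hχ'.1
    (eq_of_solutions hχ.1 hχ'.1 hβ (hy.trans k1.symm) (hy'.trans k2.symm))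
  rwa [this]

end

end FigEight

theorem proposition6p2 :
    -- there is exactly one component lying over the plane `U₁`
    (∃! V : Set CharVar, IsV1 V) ∧
    ∀ V : Set CharVar, IsV1 V →
      -- it consists of the characters whose coordinates satisfy the equations
      V = {χ | ∀ p ∈ eqsV1, MvPolynomial.aeval (coords χ) p = 0} ∧
      -- the coordinates identify it with the full solution set of the equations
      Set.BijOn coords V {x | ∀ p ∈ eqsV1, MvPolynomial.aeval x p = 0} ∧
      -- and the equations generate the ideal of all polynomial relations between the coordinates
      MvPolynomial.vanishingIdeal ℂ (coords '' V) = Ideal.span eqsV1 ∧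
      -- its reducible characters are exactly `μ₃ • (2, 2, 2, 2, 1, 1, 1, 1)`
      coords8 '' (V ∩ Xred) =
        (fun ω => centreAct ω ![2, 2, 2, 2, 1, 1, 1, 1]) '' {ω : ℂ | ω ^ 3 = 1} ∧
      -- and they are characters of partially reducible representations
      V ∩ Xred ⊆ Xpr := by
  refine ⟨⟨V1, isV1_V1, fun V hV => eq_V1_of_isV1 hV⟩, fun V hV => ?_⟩
  obtain rfl := eq_V1_of_isV1 hV
  exact ⟨rfl, coords_bijOn, vanishingIdeal_coords, coords8_image, V1_inter_Xred_subset⟩
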